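/- **Setting.** Let $x^0=u$, $x^1=r$, $x^2=\theta$, $x^3=\psi$ with $r>r_0$, $0<\theta<\pi$, $0\le\psi\le2\pi$, write $f_{,i}=\partial f/\partial x^i$, and consider Bondi's radiating metric $$\tilde g=\Big(\tfrac Vr e^{2\beta}+r^2e^{2\gamma}U^2\cosh2\delta+r^2e^{-2\gamma}W^2\cosh2\delta+2r^2UW\sinh2\delta\Big)du^2-2e^{2\beta}du\,dr-2r^2\big(e^{2\gamma}U\cosh2\delta+W\sinh2\delta\big)du\,d\theta$$ $$-2r^2\big(e^{-2\gamma}W\cosh2\delta+U\sinh2\delta\big)\sin\theta\,du\,d\psi+r^2\big(e^{2\gamma}\cosh2\delta\,d\theta^2+e^{-2\gamma}\cosh2\delta\sin^2\theta\,d\psi^2+2\sinh2\delta\sin\theta\,d\theta\,d\psi\big)$$ with smooth functions $\beta,\gamma,\delta,U,V,W$ of $(u,r,\theta,\psi)$. Suppose that it has the asymptotic behaviour of an outgoing radiating (vacuum) metric: there are functions $c,d,M,C,H,p,\bar p,\bar M$ of $(u,\theta,\psi)$, smooth for $0<\theta<\pi$, with $c$ continuous up to the poles $\theta=0,\pi$,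 such that $$\gamma=\frac cr+\frac{C-\frac16c^3-\frac32cd^2}{r^3}+O(r^{-4}),\quad \delta=\frac dr+\frac{H+\frac12c^2d-\frac16d^3}{r^3}+O(r^{-4}),\quad \beta=-\frac{c^2+d^2}{4r^2}+O(r^{-4}),$$ $$U=-\frac l{r^2}+\frac p{r^3}+O(r^{-4}),\quad W=-\frac{\bar l}{r^2}+\frac{\bar p}{r^3}+O(r^{-4}),\quad V=-r+2M+\frac{\bar M}r+O(r^{-2}),$$ $$l=c_{,2}+2c\cot\theta+d_{,3}\csc\theta,\qquad \bar l=d_{,2}+2d\cot\theta-c_{,3}\csc\theta .$$ Here each remainder and its first partial derivatives satisfy the $O$-bound for $r$ sufficiently large, uniformly in the angles and in $u\le u_1$, for every $u_1$. (The vacuum equations enter only through these expansions, and the statement holds for every metric that has them.) Assume further: * **Condition A.** Each of $\beta,\gamma,\delta,U,V,W$, together with its derivatives up to second order, takes equal values at $\psi=0$ and $\psi=2\pi$. * **Condition B.** $\int_0^{2\pi}c(u,0,\psi)\,d\psi=\int_0^{2\pi}c(u,\pi,\psi)\,d\psi=0$ for all $u$. * **Condition D.** $\gamma,\delta\in\mathcal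 C_{\{1,1,1\}}$, $\beta,U,W\in\mathcal C_{\{2,2,2\}}$, $V+r\in\mathcal C_{\{0,0,0\}}$, where $f\in\mathcal C_{\{a_1,a_2,a_3\}}$ means that $r^{a_1}f$, $r^{a_2}\breve\nabla_if$, $r^{a_3}\breve\nabla_i\breve\nabla_jf$ are bounded on some region $\{u\le u_1,\ r\ge R\}$. Here $\breve\nabla_1,\breve\nabla_2,\breve\nabla_3$ are the derivatives along the flat frame $\partial_r,\ \frac1r\partial_\theta,\ \frac1{r\sin\theta}\partial_\psi$ of the slices $t=u+r=\text{const}$; thus in the coordinates $(u,r,\theta,\psi)$ the first one is $\partial_r-\partial_u$. Let $g$ and $h$ be the metric and second fundamental form induced by $\tilde g$ on $\{t=u+r=t_0\}$, with $h_{ij}=\frac1{2\mathcal N}(\nabla_iX_j+\nabla_jX_i-\partial_t\tilde g_{ij})$, lapse $\mathcal N=(-\tilde g^{tt})^{-1/2}$, shift $X_i=\tilde g_{ti}$. Let $y^1=r\sin\theta\cos\psi$, $y^2=r\sin\theta\sin\psi$, $y^3=r\cos\theta$, $n^k=y^k/r$, and $$\mathbb P_k(t_0;r)=\frac1{8\pi}\int_0^\pi\!\!\int_0^{2\pi}\Big[h\big(\tfrac{\partial}{\partial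 y^k},\tfrac{\partial}{\partial r}\big)-g\big(\tfrac{\partial}{\partial y^k},\tfrac{\partial}{\partial r}\big)\,\mathrm{tr}_g h\Big]r^2\sin\theta\,d\psi\,d\theta,\qquad \mathbb P_k(t_0)=\lim_{r\to\infty}\mathbb P_k(t_0;r)$$ (the ADM total linear momentum), and let $$m_k(u)=\frac1{4\pi}\int_0^\pi\!\!\int_0^{2\pi}M(u,\theta,\psi)\,n^k\sin\theta\,d\psi\,d\theta,\qquad m_k(-\infty)=\lim_{u\to-\infty}m_k(u)$$ be the Bondi momentum. Put $$\mathcal P_1=\big[(c_{,0}+M_{,0})\cos\theta\cos\psi-d_{,0}\sin\psi\big]l\sin\theta+\big[(c_{,0}-M_{,0})\sin\psi+d_{,0}\cos\theta\cos\psi\big]\bar l\sin\theta,$$ $$\mathcal P_2=\big[(c_{,0}+M_{,0})\cos\theta\sin\psi+d_{,0}\cos\psi\big]l\sin\theta-\big[(c_{,0}-M_{,0})\cos\psi-d_{,0}\cos\theta\sin\psi\big]\bar l\sin\theta,$$ $$\mathcal P_3=-(c_{,0}+M_{,0})\,l\sin^2\theta-d_{,0}\,\bar l\sin^2\theta .$$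 **Theorem.** For every $t_0$ and $k=1,2,3$, $$\mathbb P_k(t_0;r)-m_k(t_0-r)-\frac1{8\pi}\int_0^\pi\!\!\int_0^{2\pi}\mathcal P_k(t_0-r,\theta,\psi)\,d\psi\,d\theta\longrightarrow0\qquad(r\to\infty).$$ Moreover, if $m_k(-\infty)$ exists, then the limit of $\int_0^\pi\int_0^{2\pi}\mathcal P_k\,d\psi\,d\theta$ as $u\to-\infty$ exists if and only if the limit $\mathbb P_k(t_0)$ exists, and in that case $$\mathbb P_k(t_0)=m_k(-\infty)+\frac1{8\pi}\lim_{u\to-\infty}\int_0^\pi\!\!\int_0^{2\pi}\mathcal P_k\,d\psi\,d\theta .$$ -/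

import Mathlib

open Real Filter Topology
open scoped ContDiff

noncomputable section

namespace BondiADM

/-- Coordinate tuples: either `(u, r, θ, ψ)` or `(t, r, θ, ψ)`, numbered `0, 1, 2, 3`. -/
abbrev Coord := Fin 4 → ℝ

/-- The partial derivative `f_{,i} = ∂f/∂xⁱ`. -/
def pd (i : Fin 4) (f : Coord → ℝ) (x : Coord) : ℝ :=
  fderiv ℝ f x (Pi.single i 1)

/-- A function `a(u, θ, ψ)` regarded as an `r`-independent function on the coordinate chart. -/
def lift (a : ℝ → ℝ → ℝ → ℝ) : Coord → ℝ := fun x => a (x 0) (x 2) (x 3)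

/-- The data of Bondi's radiating metric in the chart `(u, r, θ, ψ)`, `r > r₀`: the six metric
functions, and the coefficient functions of their expansions in `1/r`. -/
structure BondiData where
  /-- the chart is `r > r₀` -/
  r₀ : ℝ
  β : Coord → ℝ
  γ : Coord → ℝ
  δ : Coord → ℝ
  U : Coord → ℝ
  V : Coord → ℝ
  W : Coord → ℝ
  /-- `c` and `d`; their `u`-derivatives are the news functions -/
  c : ℝ → ℝ → ℝ → ℝ
  d : ℝ → ℝ → ℝ → ℝ
  /-- the mass aspect -/
  M : ℝ → ℝ → ℝ → ℝ
  /-- subleading coefficients -/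
  C : ℝ → ℝ → ℝ → ℝ
  H : ℝ → ℝ → ℝ → ℝ
  p : ℝ → ℝ → ℝ → ℝ
  pBar : ℝ → ℝ → ℝ → ℝ
  MBar : ℝ → ℝ → ℝ → ℝ

/-- The range of the angles: `0 < θ < π` (polar coordinates degenerate at the poles),
`0 ≤ ψ ≤ 2π`. -/
def Angles (x : Coord) : Prop := 0 < x 2 ∧ x 2 < π ∧ 0 ≤ x 3 ∧ x 3 ≤ 2 * π

/-- The part `u ≤ u₁`, `r ≥ R` of the spacetime. For every `t₀` it contains the part of the slice
`u + r = t₀` on which `r` is large. -/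
def Region (u₁ R : ℝ) (x : Coord) : Prop := x 0 ≤ u₁ ∧ R ≤ x 1 ∧ Angles x

/-- `f = O(1/rⁿ)` for `r` sufficiently large, uniformly in the angles and as `u → -∞`, for `f` and
its first partial derivatives. -/
def IsBigORem (n : ℕ) (f : Coord → ℝ) : Prop :=
  ∀ u₁ : ℝ, ∃ K R : ℝ, ∀ x : Coord, Region u₁ R x →
    |f x| ≤ K / x 1 ^ n ∧ ∀ i : Fin 4, |pd i f x| ≤ K / x 1 ^ n

/-- The flat frame `∂_r`, `r⁻¹ ∂_θ`, `(r sin θ)⁻¹ ∂_ψ` of the slices `t = u + r = const`, acting on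
functions given in the coordinates `(u, r, θ, ψ)`. The derivative `∂_r` at fixed `t` equals
`∂_r - ∂_u` in these coordinates. -/
def frameD (i : Fin 3) (f : Coord → ℝ) (x : Coord) : ℝ :=
  ![pd 1 f x - pd 0 f x, pd 2 f x / x 1, pd 3 f x / (x 1 * sin (x 2))] i

/-- The class `𝒞_{a₁, a₂, a₃}`: near spatial infinity `r^{a₁} f`, `r^{a₂} ∇̆ᵢ f` and
`r^{a₃} ∇̆ᵢ ∇̆ⱼ f` are `O(1)`. -/
def InClass (a₁ a₂ a₃ : ℕ) (f : Coord → ℝ) : Prop :=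
  ∃ K R u₁ : ℝ, ∀ x : Coord, Region u₁ R x →
    |x 1 ^ a₁ * f x| ≤ K ∧
    (∀ i : Fin 3, |x 1 ^ a₂ * frameD i f x| ≤ K) ∧
    ∀ i j : Fin 3, |x 1 ^ a₃ * frameD i (frameD j f) x| ≤ K

/-- `f` together with its derivatives up to second order takes the same values at `ψ = 0` and
`ψ = 2π`. -/
def EqualAtEnds (r₀ : ℝ) (f : Coord → ℝ) : Prop :=
  ∀ u r θ : ℝ, r₀ < r → 0 < θ → θ < π →
    f ![u, r, θ, 0] = f ![u, r, θ, 2 * π] ∧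
    (∀ i : Fin 4, pd i f ![u, r, θ, 0] = pd i f ![u, r, θ, 2 * π]) ∧
    ∀ i j : Fin 4, pd i (pd j f) ![u, r, θ, 0] = pd i (pd j f) ![u, r, θ, 2 * π]

/-- The unit radial vector `(n¹, n², n³)`. -/
def n (k : Fin 3) (θ ψ : ℝ) : ℝ :=
  ![sin θ * cos ψ, sin θ * sin ψ, cos θ] k

/-- The components of `∂/∂yᵏ` in the polar coordinate basis `∂_r, ∂_θ, ∂_ψ` of `ℝ³`, where
`y¹ = r sin θ cos ψ`, `y² = r sin θ sin ψ`, `y³ = r cos θ`. -/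
def dy (k : Fin 3) (r θ ψ : ℝ) : Fin 3 → ℝ :=
  ![![sin θ * cos ψ, cos θ * cos ψ / r, -(sin ψ / (r * sin θ))],
    ![sin θ * sin ψ, cos θ * sin ψ / r, cos ψ / (r * sin θ)],
    ![cos θ, -(sin θ / r), 0]] k

namespace BondiData

variable (S : BondiData)

/-- `l = c_{,2} + 2 c cot θ + d_{,3} csc θ`. -/
def l (x : Coord) : ℝ :=
  pd 2 (lift S.c) x + 2 * lift S.c x * (cos (x 2) / sin (x 2)) + pd 3 (lift S.d) x / sin (x 2)

/-- `l̄ = d_{,2} + 2 d cot θ - c_{,3} csc θ`. -/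
def lBar (x : Coord) : ℝ :=
  pd 2 (lift S.d) x + 2 * lift S.d x * (cos (x 2) / sin (x 2)) - pd 3 (lift S.c) x / sin (x 2)

/-- All functions are smooth where the coordinates are regular, and `c` extends continuously to
the poles. The angle `ψ` is allowed to range over `ℝ`, so that partial derivatives at `ψ = 0` and
`ψ = 2π` make sense; periodicity is not part of this condition. -/
structure Smooth : Prop where
  metric : ∀ f ∈ [S.β, S.γ, S.δ, S.U, S.V, S.W],
    ContDiffOn ℝ ∞ f {x | S.r₀ < x 1 ∧ 0 < x 2 ∧ x 2 < π}
  coeff : ∀ a ∈ [S.c, S.d, S.M, S.C, S.H, S.p, S.pBar, S.MBar],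
    ContDiffOn ℝ ∞ (lift a) {x | 0 < x 2 ∧ x 2 < π}
  poles : Continuous (lift S.c)

/-- The asymptotic behaviour of an outgoing radiating metric of Bondi's type. -/
structure OutgoingRadiation : Prop where
  γ_exp : IsBigORem 4 fun x => S.γ x -
    (lift S.c x / x 1 +
      (lift S.C x - (1 / 6) * lift S.c x ^ 3 - (3 / 2) * lift S.c x * lift S.d x ^ 2) / x 1 ^ 3)
  δ_exp : IsBigORem 4 fun x => S.δ x -
    (lift S.d x / x 1 +
      (lift S.H x + (1 / 2) * lift S.c x ^ 2 * lift S.d x - (1 / 6) * lift S.d x ^ 3) / x 1 ^ 3)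
  β_exp : IsBigORem 4 fun x => S.β x -
    (-(lift S.c x ^ 2 + lift S.d x ^ 2) / (4 * x 1 ^ 2))
  U_exp : IsBigORem 4 fun x => S.U x - (-S.l x / x 1 ^ 2 + lift S.p x / x 1 ^ 3)
  W_exp : IsBigORem 4 fun x => S.W x - (-S.lBar x / x 1 ^ 2 + lift S.pBar x / x 1 ^ 3)
  V_exp : IsBigORem 2 fun x => S.V x - (-x 1 + 2 * lift S.M x + lift S.MBar x / x 1)

/-- Condition A. -/
def ConditionA : Prop :=
  ∀ f ∈ [S.β, S.γ, S.δ, S.U, S.V, S.W], EqualAtEnds S.r₀ f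

/-- Condition B. -/
def ConditionB : Prop :=
  ∀ u : ℝ, ∫ ψ in (0 : ℝ)..(2 * π), S.c u 0 ψ = 0 ∧ ∫ ψ in (0 : ℝ)..(2 * π), S.c u π ψ = 0

/-- Condition D. -/
structure ConditionD : Prop where
  γ_mem : InClass 1 1 1 S.γ
  δ_mem : InClass 1 1 1 S.δ
  β_mem : InClass 2 2 2 S.β
  U_mem : InClass 2 2 2 S.U
  W_mem : InClass 2 2 2 S.W
  V_mem : InClass 0 0 0 fun x => S.V x + x 1

/-- `r² h_{AB} U^A U^B`, where `(U^A) = (U, W / sin θ)`: the quadratic part of `g̃_{uu}`. -/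
def quad (x : Coord) : ℝ :=
  x 1 ^ 2 * exp (2 * S.γ x) * S.U x ^ 2 * cosh (2 * S.δ x)
    + x 1 ^ 2 * exp (-2 * S.γ x) * S.W x ^ 2 * cosh (2 * S.δ x)
    + 2 * x 1 ^ 2 * S.U x * S.W x * sinh (2 * S.δ x)

/-- `g̃_{uu}`. -/
def gUU (x : Coord) : ℝ := S.V x / x 1 * exp (2 * S.β x) + S.quad x

/-- `g̃_{uθ}`. -/
def gUθ (x : Coord) : ℝ :=
  -(x 1 ^ 2 * (exp (2 * S.γ x) * S.U x * cosh (2 * S.δ x) + S.W x * sinh (2 * S.δ x)))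

/-- `g̃_{uψ}`. -/
def gUψ (x : Coord) : ℝ :=
  -(x 1 ^ 2 * (exp (-2 * S.γ x) * S.W x * cosh (2 * S.δ x) + S.U x * sinh (2 * S.δ x))
    * sin (x 2))

/-- `g̃_{θψ}`. -/
def gθψ (x : Coord) : ℝ := x 1 ^ 2 * sinh (2 * S.δ x) * sin (x 2)

/-- Bondi's radiating metric `g̃` in the coordinates `(u, r, θ, ψ)`. -/
def metric (x : Coord) : Matrix (Fin 4) (Fin 4) ℝ :=
  !![S.gUU x, -exp (2 * S.β x), S.gUθ x, S.gUψ x;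
     -exp (2 * S.β x), 0, 0, 0;
     S.gUθ x, 0, x 1 ^ 2 * exp (2 * S.γ x) * cosh (2 * S.δ x), S.gθψ x;
     S.gUψ x, 0, S.gθψ x, x 1 ^ 2 * exp (-2 * S.γ x) * cosh (2 * S.δ x) * sin (x 2) ^ 2]

/-- The metric `g̃` in the coordinates `y = (t, r, θ, ψ)` with `t = u + r`, that is, after the
substitution `du = dt - dr`. -/
def metricT (y : Coord) : Matrix (Fin 4) (Fin 4) ℝ :=
  let J : Matrix (Fin 4) (Fin 4) ℝ := !![1, -1, 0, 0; 0, 1, 0, 0; 0, 0, 1, 0; 0, 0, 0, 1]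
  J.transpose * S.metric ![y 0 - y 1, y 1, y 2, y 3] * J

/-- The metric `g` induced on the slices `t = const`, in the coordinates `(r, θ, ψ)`. -/
def g (y : Coord) : Matrix (Fin 3) (Fin 3) ℝ := fun i j => S.metricT y i.succ j.succ

/-- The lapse `𝒩 = (-g̃^{tt})^{-1/2}`. -/
def lapse (y : Coord) : ℝ := 1 / √(-((S.metricT y)⁻¹ 0 0))

/-- The shift `X_i = g̃_{ti}`. -/
def shift (i : Fin 3) (y : Coord) : ℝ := S.metricT y 0 i.succ

/-- The Christoffel symbols `Γᵏᵢⱼ` of the induced metric. -/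
def christoffel (k i j : Fin 3) (y : Coord) : ℝ :=
  (1 / 2) * ∑ m : Fin 3, (S.g y)⁻¹ k m *
    (pd i.succ (fun z => S.g z m j) y + pd j.succ (fun z => S.g z m i) y
      - pd m.succ (fun z => S.g z i j) y)

/-- `∇ᵢ Xⱼ` for the Levi-Civita connection of the induced metric. -/
def covShift (i j : Fin 3) (y : Coord) : ℝ :=
  pd i.succ (S.shift j) y - ∑ k : Fin 3, S.christoffel k i j y * S.shift k y

/-- The second fundamental form
`h_{ij} = (∇ᵢ Xⱼ + ∇ⱼ Xᵢ - ∂ₜ g̃_{ij}) / (2 𝒩)` of the slices. -/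
def h (y : Coord) : Matrix (Fin 3) (Fin 3) ℝ := fun i j =>
  1 / (2 * S.lapse y) *
    (S.covShift i j y + S.covShift j i y - pd 0 (fun z => S.g z i j) y)

/-- `tr_g h`. -/
def trH (y : Coord) : ℝ := ∑ i : Fin 3, ∑ j : Fin 3, (S.g y)⁻¹ i j * S.h y i j

/-- `h(∂/∂yᵏ, ∂/∂r) - g(∂/∂yᵏ, ∂/∂r) tr_g h` at the point `y = (t, r, θ, ψ)`. -/
def admIntegrand (k : Fin 3) (y : Coord) : ℝ :=
  ∑ i : Fin 3, dy k (y 1) (y 2) (y 3) i * (S.h y i 0 - S.g y i 0 * S.trH y)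

/-- The momentum integral over the coordinate sphere of radius `r` in the slice `t = t₀`. The ADM
total linear momentum `ℙ_k(t₀)` is its limit as `r → ∞`. -/
def admMomentumAt (k : Fin 3) (t₀ r : ℝ) : ℝ :=
  1 / (8 * π) * ∫ θ in (0 : ℝ)..π, ∫ ψ in (0 : ℝ)..(2 * π),
    S.admIntegrand k ![t₀, r, θ, ψ] * (r ^ 2 * sin θ)

/-- The Bondi momentum `m_k(u)`. -/
def bondiMomentum (k : Fin 3) (u : ℝ) : ℝ :=
  1 / (4 * π) * ∫ θ in (0 : ℝ)..π, ∫ ψ in (0 : ℝ)..(2 * π), S.M u θ ψ * n k θ ψ * sin θ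

/-- The densities `𝒫₁, 𝒫₂, 𝒫₃`. -/
def calP (k : Fin 3) (x : Coord) : ℝ :=
  let c₀ := pd 0 (lift S.c) x
  let d₀ := pd 0 (lift S.d) x
  let M₀ := pd 0 (lift S.M) x
  let θ := x 2
  let ψ := x 3
  ![((c₀ + M₀) * cos θ * cos ψ - d₀ * sin ψ) * S.l x * sin θ
      + ((c₀ - M₀) * sin ψ + d₀ * cos θ * cos ψ) * S.lBar x * sin θ,
    ((c₀ + M₀) * cos θ * sin ψ + d₀ * cos ψ) * S.l x * sin θ
      - ((c₀ - M₀) * cos ψ - d₀ * cos θ * sin ψ) * S.lBar x * sin θ,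
    -((c₀ + M₀) * S.l x * sin θ ^ 2) - d₀ * S.lBar x * sin θ ^ 2] k

/-- `∫∫ 𝒫_k dψ dθ` at retarded time `u`. The integrand does not depend on `r`, whose slot is
filled with `1`. -/
def newsIntegral (k : Fin 3) (u : ℝ) : ℝ :=
  ∫ θ in (0 : ℝ)..π, ∫ ψ in (0 : ℝ)..(2 * π), S.calP k ![u, 1, θ, ψ]

end BondiData

end BondiADM

end

/-!
The momentum density of a slice `u + r = t₀` is computed exactly and then expanded at infinity.

*Exact computation.* With `Λ = e^{2β} (2 + V/r)`, `σ = (2 + V/r)⁻¹`, `q` the metric of the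
coordinate spheres and `U^A = (U, W / sin θ)`, the slice has metric
`Λ dr² + q_{AB} (dx^A + U^A dr) (dx^B + U^B dr)` and lapse `√Λ σ`. The components of `K = 2 𝒩 h` are
decomposed along `ν = ∂_r - U^A ∂_A`, which is orthogonal to the spheres, and along the spheres
(`SliceJet.Kνν_eq`, `SliceJet.Kν_zero`, `SliceJet.Kν_one`, `SliceJet.trK_eq`). The trace of `K` over
the spheres involves `q` through `det q = r⁴ sin² θ` only. After multiplication by `r² sin θ`, the
momentum density is a polynomial in quantities such as `r² U`, `r³ ∂_r U`, `r ∂_u γ`, `r (σ - 1)`,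
`sin θ`, `cos θ`, `1/r`, without any division by `sin θ` (`BondiData.density`, `admIntegrand_eq`).

*Limit.* Along the slice, `r → ∞` forces `u → -∞`, and Condition D bounds the metric functions
uniformly in the angles there. Comparing an expansion in `1/r` with these bounds on a shell
`R ≤ r ≤ 2R` bounds its coefficients `c, d, l, l̄, M` and their first derivatives up to the poles
and as `u → -∞` (`bounded_of_shell`, `expansion`). Hence each of the quantities above equals its leading
term up to `O(1/r)`, uniformly on the sphere. This relation (`Approx`) is a congruence for the ring
operations, and the density is `𝒫_k` plus terms linear in `M`, `l`, `l̄` up to `O(1/r)`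
(`density_approx`).

*Integration.* The terms quadratic in the metric functions are exactly `𝒫_k`. The linear terms are
`2 M n^k sin θ` minus a divergence (`linDensity_eq`). The divergence integrates to zero: its
`ψ`-part by Condition A, its `θ`-part because its potential carries a factor `sin θ`. What remains
is `8π` times the Bondi momentum (`tendsto_admMomentumAt_sub`); substituting `u = t₀ - r` in this
limit gives the equivalence of the two limits.
-/

namespace BondiADM

/-! ### Asymptotics near spatial infinity -/

/-- The filter `r → ∞`, `u → -∞`, uniform in the angles: the regime of the slices `u + r = t₀`
near spatial infinity. -/
def spatialInf : Filter Coord :=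
  comap (fun x => x 1) atTop ⊓ comap (fun x => x 0) atBot ⊓ 𝓟 {x | Angles x}

theorem eventually_spatialInf {P : Coord → Prop} :
    (∀ᶠ x in spatialInf, P x) ↔ ∃ u₁ R : ℝ, ∀ x, Region u₁ R x → P x := by
  have hb : spatialInf.HasBasis (fun _ : ℝ × ℝ => True)
      (fun q => {x : Coord | Region q.2 q.1 x}) := by
    have h := (((atTop_basis (α := ℝ)).comap (fun x : Coord => x 1)).inf
      ((atBot_basis (α := ℝ)).comap (fun x : Coord => x 0))).inf_principal {x | Angles x}
    refine (h.to_hasBasis (p' := fun _ : ℝ × ℝ => True)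
      (s' := fun q => {x : Coord | Region q.2 q.1 x}) ?_ ?_)
    · intro q _
      exact ⟨q, trivial, fun x hx => ⟨⟨hx.2.1, hx.1⟩, hx.2.2⟩⟩
    · intro q _
      exact ⟨q, ⟨trivial, trivial⟩, fun x hx => ⟨hx.1.2, hx.1.1, hx.2⟩⟩
  rw [hb.eventually_iff]
  constructor
  · rintro ⟨⟨R, u⟩, -, h⟩
    exact ⟨u, R, fun x hx => h hx⟩
  · rintro ⟨u, R, h⟩
    exact ⟨(R, u), trivial, fun x hx => h x hx⟩

theorem eventually_region (u₁ R : ℝ) : ∀ᶠ x in spatialInf, Region u₁ R x :=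
  eventually_spatialInf.2 ⟨u₁, R, fun _ h => h⟩

theorem eventually_gt (R : ℝ) : ∀ᶠ x in spatialInf, R < x 1 :=
  (eventually_region 0 (R + 1)).mono fun _ h => (lt_add_one R).trans_le h.2.1

theorem Angles.sin_pos {x : Coord} (h : Angles x) : 0 < sin (x 2) :=
  Real.sin_pos_of_pos_of_lt_pi h.1 h.2.1

/-- Along the slice `u + r = t₀` a property that holds near spatial infinity holds on all large
spheres. -/
theorem eventually_slice {P : Coord → Prop} (h : ∀ᶠ x in spatialInf, P x) (t₀ : ℝ) :
    ∀ᶠ r : ℝ in atTop, ∀ θ ψ, 0 < θ → θ < π → 0 ≤ ψ → ψ ≤ 2 * π → P ![t₀ - r, r, θ, ψ] := by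
  obtain ⟨u₁, R, h⟩ := eventually_spatialInf.1 h
  filter_upwards [eventually_ge_atTop R, eventually_ge_atTop (t₀ - u₁)] with r h1 h2 θ ψ a b c d
  exact h _ ⟨by simpa using by linarith, by simpa using h1, by simpa [Angles] using ⟨a, b, c, d⟩⟩

/-- `f` is bounded near spatial infinity. -/
def Bdd (f : Coord → ℝ) : Prop := f =O[spatialInf] (fun _ => (1 : ℝ))

/-- `f = f₀ + O(1/r)` near spatial infinity, with `f₀` bounded. This is a congruence for the ring
operations. -/
def Approx (f f₀ : Coord → ℝ) : Prop :=
  (fun x => f x - f₀ x) =O[spatialInf] (fun x => (x 1)⁻¹) ∧ Bdd f₀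

theorem Bdd.of_le {f : Coord → ℝ} (K : ℝ) (h : ∀ᶠ x in spatialInf, |f x| ≤ K) : Bdd f :=
  Asymptotics.IsBigO.of_bound K (h.mono fun x hx => by simpa using hx)

theorem inv_bdd : Bdd (fun x => (x 1)⁻¹) := by
  refine .of_le 1 ((eventually_gt 1).mono fun x hx => ?_)
  rw [abs_of_pos (by positivity)]
  exact inv_le_one_of_one_le₀ hx.le

theorem Bdd.mul {f g : Coord → ℝ} (hf : Bdd f) (hg : Bdd g) : Bdd (fun x => f x * g x) := by
  simpa [Bdd] using Asymptotics.IsBigO.mul hf hg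

theorem Bdd.add {f g : Coord → ℝ} (hf : Bdd f) (hg : Bdd g) : Bdd (fun x => f x + g x) :=
  Asymptotics.IsBigO.add hf hg

theorem Bdd.sub {f g : Coord → ℝ} (hf : Bdd f) (hg : Bdd g) : Bdd (fun x => f x - g x) :=
  Asymptotics.IsBigO.sub hf hg

theorem Bdd.neg {f : Coord → ℝ} (hf : Bdd f) : Bdd (fun x => -f x) :=
  Asymptotics.IsBigO.neg_left hf

theorem Bdd.const (c : ℝ) : Bdd (fun _ => c) := .of_le |c| (.of_forall fun _ => le_rfl)

theorem Bdd.congr {f g : Coord → ℝ} (hf : Bdd f) (h : ∀ᶠ x in spatialInf, f x = g x) : Bdd g :=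
  Asymptotics.IsBigO.congr' hf h .rfl

namespace Approx

variable {f g f₀ g₀ : Coord → ℝ}

theorem bdd (h : Approx f f₀) : Bdd f := by
  have := Asymptotics.IsBigO.add (h.1.trans inv_bdd) h.2
  simpa [Bdd] using this

theorem add (hf : Approx f f₀) (hg : Approx g g₀) :
    Approx (fun x => f x + g x) (fun x => f₀ x + g₀ x) :=
  ⟨(hf.1.add hg.1).congr_left fun x => by ring, hf.2.add hg.2⟩

theorem sub (hf : Approx f f₀) (hg : Approx g g₀) :
    Approx (fun x => f x - g x) (fun x => f₀ x - g₀ x) :=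
  ⟨(hf.1.sub hg.1).congr_left fun x => by ring, hf.2.sub hg.2⟩

theorem neg (hf : Approx f f₀) : Approx (fun x => -f x) (fun x => -f₀ x) :=
  ⟨hf.1.neg_left.congr_left fun x => by ring, hf.2.neg⟩

theorem mul (hf : Approx f f₀) (hg : Approx g g₀) :
    Approx (fun x => f x * g x) (fun x => f₀ x * g₀ x) := by
  refine ⟨?_, hf.2.mul hg.2⟩
  have h1 := Asymptotics.IsBigO.mul hf.1 hg.bdd
  have h2 := Asymptotics.IsBigO.mul hf.2 hg.1
  simp only [mul_one, one_mul] at h1 h2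
  exact (h1.add h2).congr_left fun x => by ring

theorem pow (hf : Approx f f₀) (k : ℕ) : Approx (fun x => f x ^ k) (fun x => f₀ x ^ k) := by
  induction k with
  | zero => simpa using ⟨by simpa using Asymptotics.isBigO_zero _ _, Bdd.const 1⟩
  | succ k ih => simpa only [pow_succ] using ih.mul hf

theorem refl (hf : Bdd f) : Approx f f := ⟨by simpa using Asymptotics.isBigO_zero _ _, hf⟩

theorem const (c : ℝ) : Approx (fun _ => c) (fun _ => c) := refl (.const c)

theorem inv_r : Approx (fun x => (x 1)⁻¹) (fun _ => 0) :=
  ⟨by simpa using Asymptotics.isBigO_refl _ _, .const 0⟩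

theorem congr (h : Approx f f₀) (hf : ∀ᶠ x in spatialInf, f x = g x)
    (h₀ : ∀ᶠ x in spatialInf, f₀ x = g₀ x) : Approx g g₀ :=
  ⟨h.1.congr' (by filter_upwards [hf, h₀] with x a b; rw [a, b]) .rfl, h.2.congr h₀⟩

theorem congr_left (h : Approx f f₀) (hf : ∀ᶠ x in spatialInf, f x = g x) : Approx g f₀ :=
  h.congr hf (.of_forall fun _ => rfl)

theorem congr_right (h : Approx f f₀) (h₀ : ∀ x, f₀ x = g₀ x) : Approx f g₀ :=
  h.congr (.of_forall fun _ => rfl) (.of_forall h₀)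

/-- A function with bounded `r f` is `O(1/r)`. -/
theorem zero_of_bdd (h : Bdd fun x => x 1 * f x) : Approx f fun _ => 0 := by
  refine ((refl h).mul inv_r).congr ?_ (.of_forall fun x => by simp)
  filter_upwards [eventually_gt 0] with x hx
  field_simp

theorem tendsto {c : ℝ} (h : Approx f fun _ => c) : Tendsto f spatialInf (𝓝 c) := by
  have h0 : Tendsto (fun x : Coord => (x 1)⁻¹) spatialInf (𝓝 0) :=
    tendsto_inv_atTop_zero.comp (tendsto_comap.mono_left (inf_le_left.trans inf_le_left))
  simpa using (h.1.trans_tendsto h0).add_const c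

/-- Functions differentiable at the constant limit preserve `Approx`. -/
theorem comp_const {c : ℝ} {F : ℝ → ℝ} (hF : DifferentiableAt ℝ F c)
    (h : Approx f fun _ => c) : Approx (fun x => F (f x)) fun _ => F c :=
  ⟨(hF.isBigO_sub.comp_tendsto h.tendsto).trans h.1, .const _⟩

end Approx

theorem bdd_sin (i : Fin 4) : Bdd fun x => sin (x i) :=
  .of_le 1 (.of_forall fun _ => abs_sin_le_one _)

theorem bdd_cos (i : Fin 4) : Bdd fun x => cos (x i) :=
  .of_le 1 (.of_forall fun _ => abs_cos_le_one _)

/-! ### Partial derivatives -/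

section pd

variable {f g : Coord → ℝ} {x : Coord} (i : Fin 4)

theorem pd_add (hf : DifferentiableAt ℝ f x) (hg : DifferentiableAt ℝ g x) :
    pd i (fun y => f y + g y) x = pd i f x + pd i g x := by
  simp [pd, fderiv_fun_add hf hg]

theorem pd_sub (hf : DifferentiableAt ℝ f x) (hg : DifferentiableAt ℝ g x) :
    pd i (fun y => f y - g y) x = pd i f x - pd i g x := by
  simp [pd, fderiv_fun_sub hf hg]

theorem pd_neg : pd i (fun y => -f y) x = -pd i f x := by
  simp [pd, fderiv_fun_neg]

theorem pd_mul (hf : DifferentiableAt ℝ f x) (hg : DifferentiableAt ℝ g x) :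
    pd i (fun y => f y * g y) x = pd i f x * g x + f x * pd i g x := by
  simp [pd, fderiv_fun_mul hf hg]; ring

theorem pd_const (c : ℝ) : pd i (fun _ => c) x = 0 := by simp [pd]

theorem pd_comp {F : ℝ → ℝ} {F' : ℝ} (hF : HasDerivAt F F' (f x)) (hf : DifferentiableAt ℝ f x) :
    pd i (fun y => F (f y)) x = F' * pd i f x := by
  have := (hF.comp_hasFDerivAt x hf.hasFDerivAt).fderiv
  simp only [Function.comp_def] at this
  simp [pd, this]

theorem pd_coord (j : Fin 4) : pd i (fun y => y j) x = if i = j then 1 else 0 := by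
  have : HasFDerivAt (fun y : Coord => y j) (ContinuousLinearMap.proj (R := ℝ) j) x :=
    (ContinuousLinearMap.proj (R := ℝ) (φ := fun _ : Fin 4 => ℝ) j).hasFDerivAt
  simp [pd, this.fderiv, Pi.single_apply, eq_comm]

theorem pd_congr (h : f =ᶠ[𝓝 x] g) : pd i f x = pd i g x := by simp [pd, h.fderiv_eq]

theorem contDiffOn_pd {s : Set Coord} (hs : IsOpen s) (hf : ContDiffOn ℝ ∞ f s) :
    ContDiffOn ℝ ∞ (pd i f) s :=
  (hf.fderiv_of_isOpen hs (by norm_num)).clm_apply contDiffOn_const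

/-- The partial derivative is the derivative along the coordinate line. -/
theorem hasDerivAt_line (hf : DifferentiableAt ℝ f x) {γ : ℝ → Coord} {t : ℝ}
    (hγ : HasDerivAt γ (Pi.single i 1) t) (hx : γ t = x) :
    HasDerivAt (fun s => f (γ s)) (pd i f x) t := by
  subst hx
  exact hf.hasFDerivAt.comp_hasDerivAt t hγ

end pd

/-- The part of the chart where the coordinates are regular. -/
def chart (r₀ : ℝ) : Set Coord := {x | r₀ < x 1 ∧ 0 < x 2 ∧ x 2 < π}

/-- The domain of the `r`-independent coefficients. -/
def offPoles : Set Coord := {x | 0 < x 2 ∧ x 2 < π}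

theorem isOpen_offPoles : IsOpen offPoles :=
  (isOpen_lt continuous_const (continuous_apply 2)).inter
    (isOpen_lt (continuous_apply 2) continuous_const)

theorem isOpen_chart (r₀ : ℝ) : IsOpen (chart r₀) :=
  (isOpen_lt continuous_const (continuous_apply 1)).inter isOpen_offPoles

theorem differentiableAt_of_contDiffOn {s : Set Coord} (hs : IsOpen s) {f : Coord → ℝ}
    (hf : ContDiffOn ℝ ∞ f s) {x : Coord} (hx : x ∈ s) : DifferentiableAt ℝ f x :=
  (hf.differentiableOn (by norm_num)).differentiableAt (hs.mem_nhds hx)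

theorem eventually_chart (r₀ : ℝ) : ∀ᶠ x in spatialInf, x ∈ chart r₀ := by
  filter_upwards [eventually_gt r₀, eventually_region 0 0] with x h1 h2
  exact ⟨h1, h2.2.2.1, h2.2.2.2.1⟩

/-- `a` does not depend on `r`. -/
def RIndep (a : Coord → ℝ) : Prop :=
  ∀ x y : Coord, x 0 = y 0 → x 2 = y 2 → x 3 = y 3 → a x = a y

theorem rIndep_lift (a : ℝ → ℝ → ℝ → ℝ) : RIndep (lift a) := by
  intro x y h0 h2 h3
  simp [lift, h0, h2, h3]

theorem RIndep.pd {a : Coord → ℝ} (ha : RIndep a) (i : Fin 4) : RIndep (pd i a) := by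
  intro x y h0 h2 h3
  have h : a = fun z => a (z + (y - x)) := by
    funext z
    refine ha _ _ ?_ ?_ ?_ <;> simp [h0, h2, h3]
  have h' := congrArg (fun f => fderiv ℝ f x) h
  simp only [fderiv_comp_add_right, add_sub_cancel] at h'
  simp only [BondiADM.pd, h']

theorem RIndep.pd_one {a : Coord → ℝ} (ha : RIndep a) {x : Coord} (hx : DifferentiableAt ℝ a x) :
    BondiADM.pd 1 a x = 0 := by
  have h := hasDerivAt_line 1 hx (γ := fun t => x + t • Pi.single 1 1) (t := 0)
    (by simpa using ((hasDerivAt_id (0 : ℝ)).smul_const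
      (Pi.single 1 1 : Coord)).const_add x) (by simp)
  have h2 : (fun t : ℝ => a (x + t • Pi.single 1 1)) = fun _ => a x := by
    funext t
    refine ha _ _ ?_ ?_ ?_ <;> simp
  rw [h2] at h
  exact h.unique (hasDerivAt_const _ _)

/-! ### Coefficients of an expansion in `1/r` -/

/-- Two `r`-independent functions are bounded if the combination `A + B / rʲ` is bounded on a
dyadic shell: it suffices to compare its values at the two ends of the shell. -/
theorem bounded_of_shell {A B : Coord → ℝ} (hA : RIndep A) (hB : RIndep B) {j : ℕ} (hj : 1 ≤ j)
    {u₁ R K : ℝ} (hR : 1 ≤ R)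
    (h : ∀ x, Region u₁ R x → x 1 ≤ 2 * R → |A x + B x / x 1 ^ j| ≤ K) :
    ∃ K', ∀ x : Coord, x 0 ≤ u₁ → Angles x → |A x| ≤ K' ∧ |B x| ≤ K' := by
  refine ⟨3 * K + 4 * K * R ^ j, fun x hu hx => ?_⟩
  have key : ∀ ρ, R ≤ ρ → ρ ≤ 2 * R → |A x + B x / ρ ^ j| ≤ K := by
    intro ρ h1 h2
    have := h (Function.update x 1 ρ) ⟨by simpa using hu, by simpa using h1,
      by simpa [Angles] using hx⟩ (by simpa using h2)
    rwa [hA _ x (by simp) (by simp) (by simp), hB _ x (by simp) (by simp) (by simp),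
      Function.update_self] at this
  have k1 := key R le_rfl (by linarith)
  have k2 := key (2 * R) (by linarith) le_rfl
  have hRj : 0 < R ^ j := by positivity
  set b := B x / R ^ j with hb
  have hb2 : B x / (2 * R) ^ j = b * (1 / 2) ^ j := by
    rw [hb, mul_pow, one_div, inv_pow]; field_simp
  rw [hb2] at k2
  have hBx : B x = b * R ^ j := by rw [hb]; field_simp
  have hq : ((1 : ℝ) / 2) ^ j ≤ 1 / 2 := by
    simpa using pow_le_pow_of_le_one (by norm_num : (0 : ℝ) ≤ 1 / 2) (by norm_num) hj
  have hK : 0 ≤ K := (abs_nonneg _).trans k1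
  have hb4 : |b| ≤ 4 * K := by
    have h1 : |b * (1 - (1 / 2) ^ j)| ≤ 2 * K := by
      have : b * (1 - (1 / 2) ^ j) = (A x + b) - (A x + b * (1 / 2) ^ j) := by ring
      rw [this]
      exact (abs_sub _ _).trans (by linarith)
    rw [abs_mul, abs_of_pos (by linarith : 0 < 1 - ((1 : ℝ) / 2) ^ j)] at h1
    nlinarith [abs_nonneg b]
  have hA5 : |A x| ≤ 5 * K := by
    have : A x = (A x + b) - b := by ring
    rw [this]
    exact (abs_sub _ _).trans (by linarith)
  have hBj : |B x| ≤ 4 * K * R ^ j := by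
    rw [hBx, abs_mul, abs_of_pos hRj]
    gcongr
  refine ⟨?_, by linarith⟩
  nlinarith [one_le_pow₀ hR (n := j)]

theorem pd_expansion {a b : Coord → ℝ} (ha : RIndep a) (hb : RIndep b) (k m : ℕ) {x : Coord}
    (hx : x 1 ≠ 0) (da : DifferentiableAt ℝ a x) (db : DifferentiableAt ℝ b x) :
    DifferentiableAt ℝ (fun x => a x / x 1 ^ k + b x / x 1 ^ m) x ∧
    (∀ i, i ≠ 1 → pd i (fun x => a x / x 1 ^ k + b x / x 1 ^ m) x =
      pd i a x / x 1 ^ k + pd i b x / x 1 ^ m) ∧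
    pd 1 (fun x => a x / x 1 ^ k + b x / x 1 ^ m) x =
      -(k * a x / x 1 ^ (k + 1)) - m * b x / x 1 ^ (m + 1) := by
  have d1 : DifferentiableAt ℝ (fun x : Coord => x 1) x := by fun_prop
  have hp : ∀ k : ℕ, HasDerivAt (fun t : ℝ => (t ^ k)⁻¹) (-(k / x 1 ^ (k + 1))) (x 1) := by
    intro k
    refine ((hasDerivAt_pow k (x 1)).fun_inv (pow_ne_zero _ hx)).congr_deriv ?_
    rcases k with _ | k
    · simp
    · simp only [Nat.add_sub_cancel]; field_simp; ring
  have dp : ∀ k : ℕ, DifferentiableAt ℝ (fun x : Coord => (x 1 ^ k)⁻¹) x := fun k => by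
    fun_prop (disch := exact pow_ne_zero _ hx)
  simp only [div_eq_mul_inv (a _), div_eq_mul_inv (b _)]
  refine ⟨(da.fun_mul (dp k)).fun_add (db.fun_mul (dp m)), fun i hi => ?_, ?_⟩
  · rw [pd_add i (da.fun_mul (dp k)) (db.fun_mul (dp m)), pd_mul i da (dp k), pd_mul i db (dp m),
      pd_comp i (hp k) d1, pd_comp i (hp m) d1, pd_coord, if_neg hi]
    ring
  · rw [pd_add 1 (da.fun_mul (dp k)) (db.fun_mul (dp m)), pd_mul 1 da (dp k), pd_mul 1 db (dp m),
      pd_comp 1 (hp k) d1, pd_comp 1 (hp m) d1, pd_coord, if_pos rfl, ha.pd_one da, hb.pd_one db]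
    ring

/-- If `f = a / rᵏ + b / rᵐ + O(r⁻ᴺ)` together with first derivatives, and `f` has the decay
`𝒞_{k,k,k}`, then the coefficients and their derivatives are bounded near spatial infinity, and
`f` and its first derivatives are given by the leading term. The expansion alone would not do, as
nothing else bounds the coefficients up to the poles or as `u → -∞`. -/
theorem expansion {r₀ : ℝ} {f a b : Coord → ℝ} {k m N : ℕ} (hf : ContDiffOn ℝ ∞ f (chart r₀))
    (ha : ContDiffOn ℝ ∞ a offPoles) (hb : ContDiffOn ℝ ∞ b offPoles) (ia : RIndep a)
    (ib : RIndep b) (hkm : k < m) (hN : k + 2 ≤ N)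
    (hO : IsBigORem N fun x => f x - (a x / x 1 ^ k + b x / x 1 ^ m)) (hD : InClass k k k f) :
    Approx (fun x => x 1 ^ k * f x) a ∧
    (∀ i, Approx (fun x => x 1 ^ k * pd i f x) (pd i a)) ∧
    Approx (fun x => x 1 ^ (k + 1) * pd 1 f x) (fun x => -(k * a x)) := by
  obtain ⟨j, rfl⟩ : ∃ j, m = k + j := ⟨m - k, by omega⟩
  have hj : 1 ≤ j := by omega
  obtain ⟨K₁, R₁, u₁, hD⟩ := hD
  obtain ⟨K₂, R₂, hO⟩ := hO u₁
  set rem := fun x : Coord => f x - (a x / x 1 ^ k + b x / x 1 ^ (k + j)) with hrem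
  set R := max (max R₁ R₂) (max 1 (r₀ + 1)) with hRdef
  have hR1 : 1 ≤ R := (le_max_left _ _).trans (le_max_right _ _)
  have hR0 : r₀ + 1 ≤ R := (le_max_right _ _).trans (le_max_right _ _)
  have hRR1 : R₁ ≤ R := (le_max_left _ _).trans (le_max_left _ _)
  have hRR2 : R₂ ≤ R := (le_max_right _ _).trans (le_max_left _ _)
  have mem : ∀ x, Region u₁ R x → x ∈ chart r₀ := fun x hx =>
    ⟨by linarith [hx.2.1], hx.2.2.1, hx.2.2.2.1⟩
  have hpos : ∀ x, Region u₁ R x → 0 < x 1 := fun x hx => by linarith [hx.2.1]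
  have df : ∀ x, Region u₁ R x → DifferentiableAt ℝ f x := fun x hx =>
    differentiableAt_of_contDiffOn (isOpen_chart r₀) hf (mem x hx)
  have da : ∀ x, Region u₁ R x → DifferentiableAt ℝ a x := fun x hx =>
    differentiableAt_of_contDiffOn isOpen_offPoles ha (mem x hx).2
  have db : ∀ x, Region u₁ R x → DifferentiableAt ℝ b x := fun x hx =>
    differentiableAt_of_contDiffOn isOpen_offPoles hb (mem x hx).2
  have e0 : ∀ x, Region u₁ R x → x 1 ^ k * f x = a x + b x / x 1 ^ j + x 1 ^ k * rem x := by
    intro x hx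
    have := hpos x hx
    simp only [hrem]
    field_simp
    ring
  have ei : ∀ x, Region u₁ R x → ∀ i, i ≠ 1 →
      x 1 ^ k * pd i f x = pd i a x + pd i b x / x 1 ^ j + x 1 ^ k * pd i rem x := by
    intro x hx i hi
    have := hpos x hx
    obtain ⟨d1, d2, -⟩ := pd_expansion ia ib k (k + j) this.ne' (da x hx) (db x hx)
    rw [hrem, pd_sub i (df x hx) d1, d2 i hi]
    field_simp
    ring
  have e1 : ∀ x, Region u₁ R x → x 1 ^ (k + 1) * pd 1 f x =
      -(k * a x) - (k + j : ℕ) * (b x / x 1 ^ j) + x 1 ^ (k + 1) * pd 1 rem x := by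
    intro x hx
    have := hpos x hx
    obtain ⟨d1, -, d3⟩ := pd_expansion ia ib k (k + j) this.ne' (da x hx) (db x hx)
    rw [hrem, pd_sub 1 (df x hx) d1, d3]
    field_simp
    ring
  have hremb : ∀ x, Region u₁ R x → |rem x| ≤ K₂ / x 1 ^ N ∧ ∀ i, |pd i rem x| ≤ K₂ / x 1 ^ N :=
    fun x hx => hO x ⟨hx.1, hRR2.trans hx.2.1, hx.2.2⟩
  have hK₂ : ∀ {x}, Region u₁ R x → 0 ≤ K₂ := by
    intro x hx
    have h1 := (abs_nonneg _).trans (hremb x hx).1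
    have h2 : 0 < x 1 ^ N := pow_pos (hpos x hx) N
    by_contra h
    exact absurd h1 (not_le.2 (div_neg_of_neg_of_pos (not_le.1 h) h2))
  -- the remainders beat the powers of `r` that are needed
  have small : ∀ x, Region u₁ R x → ∀ y, |y| ≤ K₂ / x 1 ^ N → ∀ q, q ≤ N →
      |x 1 ^ q * y| ≤ K₂ := by
    intro x hx y hy q hq
    have h0 := hpos x hx
    rw [abs_mul, abs_of_pos (by positivity)]
    calc x 1 ^ q * |y| ≤ x 1 ^ N * (K₂ / x 1 ^ N) := by
          have : x 1 ^ q ≤ x 1 ^ N := pow_le_pow_right₀ (by linarith [hx.2.1]) hq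
          gcongr
      _ = K₂ := by field_simp
  have hDx : ∀ x, Region u₁ R x → |x 1 ^ k * f x| ≤ K₁ ∧ ∀ i : Fin 3,
      |x 1 ^ k * frameD i f x| ≤ K₁ := fun x hx =>
    ⟨(hD x ⟨hx.1, hRR1.trans hx.2.1, hx.2.2⟩).1, (hD x ⟨hx.1, hRR1.trans hx.2.1, hx.2.2⟩).2.1⟩
  obtain ⟨K₃, hab⟩ : ∃ K', ∀ x : Coord, x 0 ≤ u₁ → Angles x → |a x| ≤ K' ∧ |b x| ≤ K' := by
    refine bounded_of_shell ia ib hj hR1 (K := K₁ + K₂) fun x hx _ => ?_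
    have : a x + b x / x 1 ^ j = x 1 ^ k * f x - x 1 ^ k * rem x := by rw [e0 x hx]; ring
    rw [this]
    exact (abs_sub _ _).trans (add_le_add (hDx x hx).1 (small x hx _ (hremb x hx).1 k (by omega)))
  -- On the shell `R ≤ r ≤ 2R` the frame derivatives of `𝒞_{k,k,k}` bound the partial ones: `r` and
  -- `r sin θ` are at most `2R`, and `∂_u` is recovered from `∂_r - ∂_u` and the bound for `∂_r`
  -- that the expansion gives.
  have hder : ∀ i, i ≠ 1 → ∃ K', ∀ x : Coord, x 0 ≤ u₁ → Angles x →
      |pd i a x| ≤ K' ∧ |pd i b x| ≤ K' := by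
    intro i hi
    suffices h : ∃ K, ∀ x, Region u₁ R x → x 1 ≤ 2 * R → |x 1 ^ k * pd i f x| ≤ K by
      obtain ⟨K, h⟩ := h
      refine bounded_of_shell (ia.pd i) (ib.pd i) hj hR1 (K := K + K₂) fun x hx hx2 => ?_
      have : pd i a x + pd i b x / x 1 ^ j = x 1 ^ k * pd i f x - x 1 ^ k * pd i rem x := by
        rw [ei x hx i hi]; ring
      rw [this]
      exact (abs_sub _ _).trans
        (add_le_add (h x hx hx2) (small x hx _ ((hremb x hx).2 i) k (by omega)))
    fin_cases i
    · refine ⟨(k * K₃ + (k + j : ℕ) * K₃ + K₂) + K₁, fun x hx _ => ?_⟩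
      have h0 := hpos x hx
      have h1r : 1 ≤ x 1 := hR1.trans hx.2.1
      have h1 := (hDx x hx).2 0
      simp only [frameD, Matrix.cons_val_zero] at h1
      have h2 : |x 1 ^ (k + 1) * pd 1 f x| ≤ k * K₃ + (k + j : ℕ) * K₃ + K₂ := by
        rw [e1 x hx]
        have t1 : |(k : ℝ) * a x| ≤ k * K₃ := by
          rw [abs_mul, Nat.abs_cast]
          exact mul_le_mul_of_nonneg_left (hab x hx.1 hx.2.2).1 (by positivity)
        have t2 : |((k + j : ℕ) : ℝ) * (b x / x 1 ^ j)| ≤ (k + j : ℕ) * K₃ := by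
          rw [abs_mul, Nat.abs_cast]
          refine mul_le_mul_of_nonneg_left ?_ (by positivity)
          rw [abs_div, abs_of_pos (pow_pos h0 j)]
          exact (div_le_self (abs_nonneg _) (one_le_pow₀ h1r)).trans (hab x hx.1 hx.2.2).2
        have t3 := small x hx _ ((hremb x hx).2 1) (k + 1) (by omega)
        refine (abs_add_le _ _).trans (add_le_add ((abs_sub _ _).trans ?_) t3)
        rw [abs_neg]
        exact add_le_add t1 t2
      have h3 : |x 1 ^ k * pd 1 f x| ≤ |x 1 ^ (k + 1) * pd 1 f x| := by
        rw [pow_succ, abs_mul, abs_mul, abs_mul, abs_of_pos h0]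
        exact mul_le_mul_of_nonneg_right (le_mul_of_one_le_right (abs_nonneg _) h1r) (abs_nonneg _)
      have h4 : x 1 ^ k * pd 0 f x =
          x 1 ^ k * pd 1 f x - x 1 ^ k * (pd 1 f x - pd 0 f x) := by ring
      change |x 1 ^ k * pd 0 f x| ≤ _
      rw [h4]
      exact (abs_sub _ _).trans (add_le_add (h3.trans h2) h1)
    · exact absurd rfl hi
    · refine ⟨2 * R * K₁, fun x hx hx2 => ?_⟩
      have h0 := hpos x hx
      have h1 := (hDx x hx).2 1
      simp only [frameD, Matrix.cons_val_one, Matrix.cons_val_zero] at h1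
      have h2 : x 1 ^ k * pd 2 f x = x 1 * (x 1 ^ k * (pd 2 f x / x 1)) := by field_simp
      change |x 1 ^ k * pd 2 f x| ≤ _
      rw [h2, abs_mul, abs_of_pos h0]
      exact mul_le_mul hx2 h1 (abs_nonneg _) (by linarith)
    · refine ⟨2 * R * K₁, fun x hx hx2 => ?_⟩
      have h0 := hpos x hx
      have hs := hx.2.2.sin_pos
      have h1 := (hDx x hx).2 2
      simp only [frameD, Matrix.cons_val] at h1
      have h2 : x 1 ^ k * pd 3 f x =
          (x 1 * sin (x 2)) * (x 1 ^ k * (pd 3 f x / (x 1 * sin (x 2)))) := by field_simp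
      change |x 1 ^ k * pd 3 f x| ≤ _
      rw [h2, abs_mul, abs_of_pos (by positivity)]
      exact mul_le_mul (by nlinarith [sin_le_one (x 2)]) h1 (abs_nonneg _) (by linarith)
  have toBdd : ∀ {A : Coord → ℝ} {K : ℝ}, (∀ x : Coord, x 0 ≤ u₁ → Angles x → |A x| ≤ K) →
      Bdd A := fun h => .of_le _ ((eventually_region u₁ 0).mono fun x hx => h x hx.1 hx.2.2)
  have hreg := eventually_region u₁ R
  have hinvj : Approx (fun x => (x 1)⁻¹ ^ j) fun _ => 0 := by
    simpa [show j ≠ 0 by omega] using Approx.inv_r.pow j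
  have remA : ∀ {y : Coord → ℝ}, (∀ x, Region u₁ R x → |y x| ≤ K₂ / x 1 ^ N) → ∀ q, q + 1 ≤ N →
      Approx (fun x => x 1 ^ q * y x) fun _ => 0 := by
    intro y hy q hq
    refine Approx.zero_of_bdd (.of_le K₂ (hreg.mono fun x hx => ?_))
    have := small x hx _ (hy x hx) (q + 1) hq
    rwa [pow_succ', mul_assoc] at this
  have hone : Approx (fun x => x 1 ^ (k + 1) * pd 1 f x) (fun x => -(k * a x)) := by
    have h := (((Approx.const (k : ℝ)).mul
        (Approx.refl (toBdd fun x h1 h2 => (hab x h1 h2).1))).neg.sub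
      ((Approx.const ((k + j : ℕ) : ℝ)).mul
        ((Approx.refl (toBdd fun x h1 h2 => (hab x h1 h2).2)).mul hinvj))).add
      (remA (fun x hx => (hremb x hx).2 1) (k + 1) (by omega))
    refine h.congr (hreg.mono fun x hx => ?_) (.of_forall fun x => by ring)
    rw [e1 x hx, inv_pow, div_eq_mul_inv]
  refine ⟨?_, fun i => ?_, hone⟩
  · have h := ((Approx.refl (toBdd fun x h1 h2 => (hab x h1 h2).1)).add
      ((Approx.refl (toBdd fun x h1 h2 => (hab x h1 h2).2)).mul hinvj)).add
      (remA (fun x hx => (hremb x hx).1) k (by omega))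
    refine h.congr (hreg.mono fun x hx => ?_) (.of_forall fun x => by ring)
    rw [e0 x hx, inv_pow, div_eq_mul_inv]
  · by_cases hi : i = 1
    · subst hi
      refine (Approx.zero_of_bdd (hone.bdd.congr (.of_forall fun x => ?_))).congr
        (.of_forall fun x => rfl) (hreg.mono fun x hx => (ia.pd_one (da x hx)).symm)
      simp only [pow_succ']; ring
    obtain ⟨K₄, h4⟩ := hder i hi
    have h := ((Approx.refl (toBdd fun x h1 h2 => (h4 x h1 h2).1)).add
      ((Approx.refl (toBdd fun x h1 h2 => (h4 x h1 h2).2)).mul hinvj)).add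
      (remA (fun x hx => (hremb x hx).2 i) k (by omega))
    refine h.congr (hreg.mono fun x hx => ?_) (.of_forall fun x => by ring)
    rw [ei x hx i hi, inv_pow, div_eq_mul_inv]

/-! ### Algebra of the slice `u + r = t₀` -/

/-- The first jet, at a point of a slice, of the quantities that determine the induced metric, the
shift and the lapse: `Λ = e^{2β} (2 + V/r)`, `σ = (2 + V/r)⁻¹`, the metric
`q = q₁₁ dθ² + 2 q₁₂ dθ dψ + q₂₂ dψ²` of the spheres, and the angular vector field
`(U₁, U₂) = (U, W / sin θ)`. The derivatives `dΛ, …` are taken along `(t, r, θ, ψ)`. -/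
structure SliceJet where
  Λ : ℝ
  σ : ℝ
  q₁₁ : ℝ
  q₁₂ : ℝ
  q₂₂ : ℝ
  U₁ : ℝ
  U₂ : ℝ
  dΛ : Fin 4 → ℝ
  dσ : Fin 4 → ℝ
  dq₁₁ : Fin 4 → ℝ
  dq₁₂ : Fin 4 → ℝ
  dq₂₂ : Fin 4 → ℝ
  dU₁ : Fin 4 → ℝ
  dU₂ : Fin 4 → ℝ

namespace SliceJet

variable (J : SliceJet)

/-- `q_{θB} U^B`. -/
def U1low : ℝ := J.q₁₁ * J.U₁ + J.q₁₂ * J.U₂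
/-- `q_{ψB} U^B`. -/
def U2low : ℝ := J.q₁₂ * J.U₁ + J.q₂₂ * J.U₂
/-- `q_{AB} U^A U^B`. -/
def normU : ℝ := J.q₁₁ * J.U₁ ^ 2 + 2 * J.q₁₂ * J.U₁ * J.U₂ + J.q₂₂ * J.U₂ ^ 2
/-- `det q`. -/
def det : ℝ := J.q₁₁ * J.q₂₂ - J.q₁₂ ^ 2

/-- The derivative of `q_{θB} U^B`. -/
def dU1low (μ : Fin 4) : ℝ :=
  J.dq₁₁ μ * J.U₁ + J.q₁₁ * J.dU₁ μ + (J.dq₁₂ μ * J.U₂ + J.q₁₂ * J.dU₂ μ)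
/-- The derivative of `q_{ψB} U^B`. -/
def dU2low (μ : Fin 4) : ℝ :=
  J.dq₁₂ μ * J.U₁ + J.q₁₂ * J.dU₁ μ + (J.dq₂₂ μ * J.U₂ + J.q₂₂ * J.dU₂ μ)
/-- The derivative of `q_{AB} U^A U^B`. -/
def dnormU (μ : Fin 4) : ℝ :=
  J.dq₁₁ μ * J.U₁ ^ 2 + 2 * J.dq₁₂ μ * J.U₁ * J.U₂ + J.dq₂₂ μ * J.U₂ ^ 2
    + 2 * (J.U1low * J.dU₁ μ + J.U2low * J.dU₂ μ)
/-- The derivative of `det q`. -/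
def ddet (μ : Fin 4) : ℝ :=
  J.dq₁₁ μ * J.q₂₂ + J.q₁₁ * J.dq₂₂ μ - 2 * J.q₁₂ * J.dq₁₂ μ

/-- The induced metric in the coordinates `(r, θ, ψ)`. -/
def g : Matrix (Fin 3) (Fin 3) ℝ :=
  !![J.Λ + J.normU, J.U1low, J.U2low; J.U1low, J.q₁₁, J.q₁₂; J.U2low, J.q₁₂, J.q₂₂]

/-- The derivatives of the induced metric. -/
def dg (μ : Fin 4) : Matrix (Fin 3) (Fin 3) ℝ :=
  !![J.dΛ μ + J.dnormU μ, J.dU1low μ, J.dU2low μ;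
     J.dU1low μ, J.dq₁₁ μ, J.dq₁₂ μ; J.dU2low μ, J.dq₁₂ μ, J.dq₂₂ μ]

/-- The inverse of the induced metric. -/
noncomputable def gInv : Matrix (Fin 3) (Fin 3) ℝ :=
  !![1 / J.Λ, -J.U₁ / J.Λ, -J.U₂ / J.Λ;
     -J.U₁ / J.Λ, J.q₂₂ / J.det + J.U₁ ^ 2 / J.Λ, -J.q₁₂ / J.det + J.U₁ * J.U₂ / J.Λ;
     -J.U₂ / J.Λ, -J.q₁₂ / J.det + J.U₁ * J.U₂ / J.Λ, J.q₁₁ / J.det + J.U₂ ^ 2 / J.Λ]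

/-- The shift as a covector. -/
def X : Fin 3 → ℝ := ![J.Λ * J.σ - J.Λ - J.normU, -J.U1low, -J.U2low]

/-- The derivatives of the shift covector. -/
def dX (μ : Fin 4) : Fin 3 → ℝ :=
  ![J.dΛ μ * J.σ + J.Λ * J.dσ μ - J.dΛ μ - J.dnormU μ, -J.dU1low μ, -J.dU2low μ]

/-- The shift as a vector. -/
def Xup : Fin 3 → ℝ := ![J.σ - 1, -(J.σ * J.U₁), -(J.σ * J.U₂)]

/-- `2 𝒩 h_{ij}`, which is the Lie derivative of `g` along the shift minus `∂ₜ g`. -/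
def K (i j : Fin 3) : ℝ :=
  J.dX i.succ j + J.dX j.succ i
    - ∑ m, J.Xup m * (J.dg i.succ m j + J.dg j.succ m i - J.dg m.succ i j) - J.dg 0 i j

theorem g_mul_gInv (hΛ : J.Λ ≠ 0) (hd : J.det ≠ 0) : J.g * J.gInv = 1 := by
  have hd' : J.q₁₁ * J.q₂₂ - J.q₁₂ ^ 2 ≠ 0 := hd
  have hd'' : J.q₂₂ * J.q₁₁ - J.q₁₂ ^ 2 ≠ 0 := by rwa [mul_comm]
  ext i j
  fin_cases i <;> fin_cases j <;>
    simp [g, gInv, Matrix.mul_apply, Fin.sum_univ_three, normU, U1low, U2low, det] <;>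
    field_simp <;> ring

theorem gInv_symm (i j : Fin 3) : J.gInv i j = J.gInv j i := by
  fin_cases i <;> fin_cases j <;> rfl

theorem gInv_mul_X (hΛ : J.Λ ≠ 0) (hd : J.det ≠ 0) (m : Fin 3) :
    ∑ k, J.gInv m k * J.X k = J.Xup m := by
  have hd' : J.q₁₁ * J.q₂₂ - J.q₁₂ ^ 2 ≠ 0 := hd
  fin_cases m <;>
    simp [gInv, X, Xup, Fin.sum_univ_three, normU, U1low, U2low, det] <;>
    field_simp <;> ring

theorem K_symm (i j : Fin 3) : J.K i j = J.K j i := by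
  fin_cases i <;> fin_cases j <;> simp [K, dg, Fin.sum_univ_three] <;> ring

/-- `K(ν, ∂_A)`, where `ν = ∂_r - U^A ∂_A` is the radial direction orthogonal to the coordinate
spheres; `g(ν, ν) = Λ`. -/
def Kν (A : Fin 2) : ℝ :=
  J.K 0 A.succ - J.U₁ * J.K 1 A.succ - J.U₂ * J.K 2 A.succ

/-- `K(ν, ν)`, with `ν` as in `Kν`. -/
def Kνν : ℝ :=
  J.K 0 0 - 2 * (J.U₁ * J.K 0 1 + J.U₂ * J.K 0 2)
    + (J.U₁ ^ 2 * J.K 1 1 + 2 * J.U₁ * J.U₂ * J.K 1 2 + J.U₂ ^ 2 * J.K 2 2)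

/-- `q^{AB} K_{AB}`. -/
noncomputable def trK : ℝ := (J.q₂₂ * J.K 1 1 - 2 * J.q₁₂ * J.K 1 2 + J.q₁₁ * J.K 2 2) / J.det

/-- The derivatives of `q` and of `U^A` cancel in this component. -/
theorem Kνν_eq : J.Kνν = (J.σ - 1) * J.dΛ 1 - J.σ * (J.U₁ * J.dΛ 2 + J.U₂ * J.dΛ 3) - J.dΛ 0
    + 2 * J.Λ * (J.dσ 1 - J.U₁ * J.dσ 2 - J.U₂ * J.dσ 3) := by
  simp [Kνν, K, dg, dX, Xup, Fin.sum_univ_three, dnormU, dU1low, dU2low, U1low, U2low]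
  ring

theorem Kν_zero : J.Kν 0 = -(J.q₁₁ * (J.dU₁ 1 + J.dU₁ 0) + J.q₁₂ * (J.dU₂ 1 + J.dU₂ 0))
    + J.Λ * J.dσ 2 := by
  simp [Kν, K, dg, dX, Xup, Fin.sum_univ_three, dnormU, dU1low, dU2low, U1low, U2low]
  ring

theorem Kν_one : J.Kν 1 = -(J.q₁₂ * (J.dU₁ 1 + J.dU₁ 0) + J.q₂₂ * (J.dU₂ 1 + J.dU₂ 0))
    + J.Λ * J.dσ 3 := by
  simp [Kν, K, dg, dX, Xup, Fin.sum_univ_three, dnormU, dU1low, dU2low, U1low, U2low]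
  ring

theorem K_one_one : J.K 1 1 = (J.σ - 1) * (J.dq₁₁ 1 + J.dq₁₁ 0) - J.σ * J.dq₁₁ 0
    - J.σ * (J.U₁ * J.dq₁₁ 2 + J.U₂ * J.dq₁₁ 3 + 2 * (J.q₁₁ * J.dU₁ 2 + J.q₁₂ * J.dU₂ 2)) := by
  simp [K, dg, dX, Xup, Fin.sum_univ_three, dU1low]
  ring

theorem K_one_two : J.K 1 2 = (J.σ - 1) * (J.dq₁₂ 1 + J.dq₁₂ 0) - J.σ * J.dq₁₂ 0
    - J.σ * (J.U₁ * J.dq₁₂ 2 + J.U₂ * J.dq₁₂ 3 + (J.q₁₂ * J.dU₁ 2 + J.q₂₂ * J.dU₂ 2)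
      + (J.q₁₁ * J.dU₁ 3 + J.q₁₂ * J.dU₂ 3)) := by
  simp [K, dg, dX, Xup, Fin.sum_univ_three, dU1low, dU2low]
  ring

theorem K_two_two : J.K 2 2 = (J.σ - 1) * (J.dq₂₂ 1 + J.dq₂₂ 0) - J.σ * J.dq₂₂ 0
    - J.σ * (J.U₁ * J.dq₂₂ 2 + J.U₂ * J.dq₂₂ 3 + 2 * (J.q₁₂ * J.dU₁ 3 + J.q₂₂ * J.dU₂ 3)) := by
  simp [K, dg, dX, Xup, Fin.sum_univ_three, dU2low]
  ring

/-- The trace over the spheres sees the metric of the spheres through its determinant only. -/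
theorem trK_eq (hd : J.det ≠ 0) : J.trK = ((J.σ - 1) * (J.ddet 1 + J.ddet 0) - J.σ * J.ddet 0
      - J.σ * (J.U₁ * J.ddet 2 + J.U₂ * J.ddet 3)) / J.det
    - 2 * J.σ * (J.dU₁ 2 + J.dU₂ 3) := by
  rw [trK, div_eq_iff hd, sub_mul, div_mul_cancel₀ _ hd, K_one_one, K_one_two, K_two_two]
  simp only [ddet, det]
  ring

theorem trace_K (hΛ : J.Λ ≠ 0) (hd : J.det ≠ 0) :
    ∑ i, ∑ j, J.gInv i j * J.K i j = J.Kνν / J.Λ + J.trK := by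
  have hd' : J.q₁₁ * J.q₂₂ - J.q₁₂ ^ 2 ≠ 0 := hd
  simp only [Fin.sum_univ_three, J.K_symm 1 0, J.K_symm 2 0, J.K_symm 2 1, Kνν, trK]
  simp [gInv, det]
  field_simp
  ring

/-- The momentum density in terms of the components of `K` with respect to `ν` and the spheres,
where `(e₀, e₁, e₂)` are the components of the translation and `E^A = e^A + e⁰ U^A`. -/
theorem momentum (e : Fin 3 → ℝ) (E₁ E₂ τ : ℝ) (h₁ : E₁ = e 1 + e 0 * J.U₁)
    (h₂ : E₂ = e 2 + e 0 * J.U₂) (hΛ : J.Λ ≠ 0) (hτ : τ = J.Kνν / J.Λ + J.trK) :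
    ∑ i, e i * (J.K i 0 - J.g i 0 * τ) =
      (e 0 * J.U₁ + E₁) * J.Kν 0 + (e 0 * J.U₂ + E₂) * J.Kν 1
      + (E₁ * J.U₁ * J.K 1 1 + (E₁ * J.U₂ + E₂ * J.U₁) * J.K 1 2 + E₂ * J.U₂ * J.K 2 2)
      - e 0 * J.Λ * J.trK
      - (E₁ * J.U1low + E₂ * J.U2low) * (J.Kνν / J.Λ + J.trK) := by
  have h : J.Λ * τ = J.Kνν + J.Λ * J.trK := by rw [hτ]; field_simp
  rw [← hτ]
  have h' : e 0 * J.Λ * J.trK = e 0 * (J.Λ * τ) - e 0 * J.Kνν := by rw [h]; ring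
  rw [h', h₁, h₂]
  simp only [Fin.sum_univ_three, Kνν, Kν, J.K_symm 1 0, J.K_symm 2 0]
  simp [g, normU, U1low, U2low, J.K_symm 2 1]
  ring

end SliceJet

/-! ### The second fundamental form of the slices -/

/-- The change of coordinates `(t, r, θ, ψ) ↦ (u, r, θ, ψ)`. -/
noncomputable def toBondi : Coord →L[ℝ] Coord :=
  ContinuousLinearMap.pi ![.proj 0 - .proj 1, .proj 1, .proj 2, .proj 3]

theorem toBondi_apply (y : Coord) : toBondi y = ![y 0 - y 1, y 1, y 2, y 3] := by
  ext i; fin_cases i <;> simp [toBondi]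

@[simp] theorem toBondi_one (y : Coord) : toBondi y 1 = y 1 := by simp [toBondi]
@[simp] theorem toBondi_two (y : Coord) : toBondi y 2 = y 2 := by simp [toBondi]
@[simp] theorem toBondi_three (y : Coord) : toBondi y 3 = y 3 := by simp [toBondi]

/-- The derivatives along `(t, r, θ, ψ)` in terms of those along `(u, r, θ, ψ)`. -/
noncomputable def slicePd (F : Coord → ℝ) (x : Coord) : Fin 4 → ℝ :=
  ![pd 0 F x, pd 1 F x - pd 0 F x, pd 2 F x, pd 3 F x]

theorem pd_toBondi {F : Coord → ℝ} {y : Coord} (hF : DifferentiableAt ℝ F (toBondi y))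
    (μ : Fin 4) : pd μ (fun z => F (toBondi z)) y = slicePd F (toBondi y) μ := by
  have h : fderiv ℝ (fun z => F (toBondi z)) y = (fderiv ℝ F (toBondi y)).comp toBondi :=
    (hF.hasFDerivAt.comp y toBondi.hasFDerivAt).fderiv
  have h0 : toBondi (Pi.single 0 1) = Pi.single 0 1 := by
    rw [toBondi_apply]; ext i; fin_cases i <;> simp
  have h1 : toBondi (Pi.single 1 1) = Pi.single 1 1 - Pi.single 0 1 := by
    rw [toBondi_apply]; ext i; fin_cases i <;> simp
  have h2 : toBondi (Pi.single 2 1) = Pi.single 2 1 := by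
    rw [toBondi_apply]; ext i; fin_cases i <;> simp
  have h3 : toBondi (Pi.single 3 1) = Pi.single 3 1 := by
    rw [toBondi_apply]; ext i; fin_cases i <;> simp
  fin_cases μ <;> simp [pd, h, slicePd, h0, h1, h2, h3]

/-- The jet at `y` built from seven functions of `(t, r, θ, ψ)`. -/
noncomputable def jetOf (Λ σ q₁₁ q₁₂ q₂₂ U₁ U₂ : Coord → ℝ) (y : Coord) : SliceJet where
  Λ := Λ y
  σ := σ y
  q₁₁ := q₁₁ y
  q₁₂ := q₁₂ y
  q₂₂ := q₂₂ y
  U₁ := U₁ y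
  U₂ := U₂ y
  dΛ μ := pd μ Λ y
  dσ μ := pd μ σ y
  dq₁₁ μ := pd μ q₁₁ y
  dq₁₂ μ := pd μ q₁₂ y
  dq₂₂ μ := pd μ q₂₂ y
  dU₁ μ := pd μ U₁ y
  dU₂ μ := pd μ U₂ y

section jetOf

variable {Λ σ q₁₁ q₁₂ q₂₂ U₁ U₂ : Coord → ℝ} {y : Coord}

theorem pd_jetOf_normU
    (h₁ : DifferentiableAt ℝ q₁₁ y) (h₂ : DifferentiableAt ℝ q₁₂ y)
    (h₃ : DifferentiableAt ℝ q₂₂ y) (h₄ : DifferentiableAt ℝ U₁ y)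
    (h₅ : DifferentiableAt ℝ U₂ y) (μ : Fin 4) :
    DifferentiableAt ℝ (fun z => (jetOf Λ σ q₁₁ q₁₂ q₂₂ U₁ U₂ z).normU) y ∧
    pd μ (fun z => (jetOf Λ σ q₁₁ q₁₂ q₂₂ U₁ U₂ z).normU) y =
      (jetOf Λ σ q₁₁ q₁₂ q₂₂ U₁ U₂ y).dnormU μ := by
  simp only [jetOf, SliceJet.normU, SliceJet.dnormU, SliceJet.U1low, SliceJet.U2low, sq]
  refine ⟨by fun_prop, ?_⟩
  simp (disch := fun_prop) only [pd_add, pd_mul, pd_const]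
  ring

theorem pd_jetOf_low
    (h₁ : DifferentiableAt ℝ q₁₁ y) (h₂ : DifferentiableAt ℝ q₁₂ y)
    (h₃ : DifferentiableAt ℝ q₂₂ y) (h₄ : DifferentiableAt ℝ U₁ y)
    (h₅ : DifferentiableAt ℝ U₂ y) (μ : Fin 4) :
    pd μ (fun z => (jetOf Λ σ q₁₁ q₁₂ q₂₂ U₁ U₂ z).U1low) y =
      (jetOf Λ σ q₁₁ q₁₂ q₂₂ U₁ U₂ y).dU1low μ ∧
    pd μ (fun z => (jetOf Λ σ q₁₁ q₁₂ q₂₂ U₁ U₂ z).U2low) y =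
      (jetOf Λ σ q₁₁ q₁₂ q₂₂ U₁ U₂ y).dU2low μ := by
  simp only [jetOf, SliceJet.dU1low, SliceJet.dU2low, SliceJet.U1low, SliceJet.U2low]
  constructor <;> simp (disch := fun_prop) only [pd_add, pd_mul]

theorem pd_jetOf_g (h₀ : DifferentiableAt ℝ Λ y)
    (h₁ : DifferentiableAt ℝ q₁₁ y) (h₂ : DifferentiableAt ℝ q₁₂ y)
    (h₃ : DifferentiableAt ℝ q₂₂ y) (h₄ : DifferentiableAt ℝ U₁ y)
    (h₅ : DifferentiableAt ℝ U₂ y) (μ : Fin 4) (i j : Fin 3) :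
    pd μ (fun z => (jetOf Λ σ q₁₁ q₁₂ q₂₂ U₁ U₂ z).g i j) y =
      (jetOf Λ σ q₁₁ q₁₂ q₂₂ U₁ U₂ y).dg μ i j := by
  obtain ⟨n1, n2⟩ := pd_jetOf_normU (Λ := Λ) (σ := σ) h₁ h₂ h₃ h₄ h₅ μ
  obtain ⟨l1, l2⟩ := pd_jetOf_low (Λ := Λ) (σ := σ) h₁ h₂ h₃ h₄ h₅ μ
  have r : pd μ (fun z => Λ z + (jetOf Λ σ q₁₁ q₁₂ q₂₂ U₁ U₂ z).normU) y =
      pd μ Λ y + (jetOf Λ σ q₁₁ q₁₂ q₂₂ U₁ U₂ y).dnormU μ := by rw [pd_add μ h₀ n1, n2]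
  fin_cases i <;> fin_cases j
  exacts [r, l1, l2, l1, rfl, rfl, l2, rfl, rfl]

theorem pd_jetOf_X (h₀ : DifferentiableAt ℝ Λ y) (h₀' : DifferentiableAt ℝ σ y)
    (h₁ : DifferentiableAt ℝ q₁₁ y) (h₂ : DifferentiableAt ℝ q₁₂ y)
    (h₃ : DifferentiableAt ℝ q₂₂ y) (h₄ : DifferentiableAt ℝ U₁ y)
    (h₅ : DifferentiableAt ℝ U₂ y) (μ : Fin 4) (j : Fin 3) :
    pd μ (fun z => (jetOf Λ σ q₁₁ q₁₂ q₂₂ U₁ U₂ z).X j) y =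
      (jetOf Λ σ q₁₁ q₁₂ q₂₂ U₁ U₂ y).dX μ j := by
  obtain ⟨n1, n2⟩ := pd_jetOf_normU (Λ := Λ) (σ := σ) h₁ h₂ h₃ h₄ h₅ μ
  obtain ⟨l1, l2⟩ := pd_jetOf_low (Λ := Λ) (σ := σ) h₁ h₂ h₃ h₄ h₅ μ
  have r : pd μ (fun z => Λ z * σ z - Λ z - (jetOf Λ σ q₁₁ q₁₂ q₂₂ U₁ U₂ z).normU) y =
      pd μ Λ y * σ y + Λ y * pd μ σ y - pd μ Λ y
        - (jetOf Λ σ q₁₁ q₁₂ q₂₂ U₁ U₂ y).dnormU μ := by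
    rw [pd_sub μ (by fun_prop) n1, pd_sub μ (by fun_prop) h₀, pd_mul μ h₀ h₀', n2]
  fin_cases j
  · exact r
  · exact (pd_neg μ).trans (congrArg Neg.neg l1)
  · exact (pd_neg μ).trans (congrArg Neg.neg l2)

end jetOf

namespace BondiData

variable (S : BondiData)

/-- `σ = (2 + V/r)⁻¹`. -/
noncomputable def sig (x : Coord) : ℝ := (2 + S.V x / x 1)⁻¹
/-- `Λ = e^{2β} (2 + V/r)`. -/
noncomputable def Lam (x : Coord) : ℝ := exp (2 * S.β x) * (2 + S.V x / x 1)
/-- The components of the unimodular metric of the spheres in the frame `∂_θ, ∂_ψ / sin θ`. -/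
noncomputable def h₁₁ (x : Coord) : ℝ := exp (2 * S.γ x) * cosh (2 * S.δ x)
/-- See `h₁₁`. -/
noncomputable def h₁₂ (x : Coord) : ℝ := sinh (2 * S.δ x)
/-- See `h₁₁`. -/
noncomputable def h₂₂ (x : Coord) : ℝ := exp (-2 * S.γ x) * cosh (2 * S.δ x)
/-- The metric of the spheres. -/
noncomputable def q₁₁ (x : Coord) : ℝ := x 1 ^ 2 * S.h₁₁ x
/-- See `q₁₁`. -/
noncomputable def q₁₂ (x : Coord) : ℝ := x 1 ^ 2 * S.h₁₂ x * sin (x 2)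
/-- See `q₁₁`. -/
noncomputable def q₂₂ (x : Coord) : ℝ := x 1 ^ 2 * S.h₂₂ x * sin (x 2) ^ 2
/-- The `∂_ψ`-component of the angular vector field `U ∂_θ + (W / sin θ) ∂_ψ`. -/
noncomputable def Uψ (x : Coord) : ℝ := S.W x / sin (x 2)

theorem unimodular (x : Coord) : S.h₁₁ x * S.h₂₂ x - S.h₁₂ x ^ 2 = 1 := by
  have h1 : exp (2 * S.γ x) * exp (-2 * S.γ x) = 1 := by rw [← exp_add]; simp
  have h2 := cosh_sq (2 * S.δ x)
  simp only [h₁₁, h₂₂, h₁₂]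
  linear_combination cosh (2 * S.δ x) ^ 2 * h1 + h2

/-- The part of the chart where the slices `u + r = const` are spacelike. -/
noncomputable def regular : Set Coord := {x | x ∈ chart S.r₀ ∧ 0 < x 1 ∧ 0 < 2 + S.V x / x 1}

/-- The jet of the metric at the point `y = (t, r, θ, ψ)`. -/
noncomputable def jet : Coord → SliceJet :=
  jetOf (fun y => S.Lam (toBondi y)) (fun y => S.sig (toBondi y)) (fun y => S.q₁₁ (toBondi y))
    (fun y => S.q₁₂ (toBondi y)) (fun y => S.q₂₂ (toBondi y)) (fun y => S.U (toBondi y))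
    (fun y => S.Uψ (toBondi y))

end BondiData

section

variable {S : BondiData} {x y : Coord}

namespace BondiData.regular

theorem pos (hx : x ∈ S.regular) : 0 < x 1 := hx.2.1
theorem sin_pos (hx : x ∈ S.regular) : 0 < sin (x 2) :=
  Real.sin_pos_of_pos_of_lt_pi hx.1.2.1 hx.1.2.2
theorem sig_pos (hx : x ∈ S.regular) : 0 < S.sig x := inv_pos.2 hx.2.2
theorem Lam_pos (hx : x ∈ S.regular) : 0 < S.Lam x := mul_pos (exp_pos _) hx.2.2
theorem Lam_mul_sig (hx : x ∈ S.regular) : S.Lam x * S.sig x = exp (2 * S.β x) := by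
  rw [Lam, sig, mul_assoc, mul_inv_cancel₀ hx.2.2.ne', mul_one]

end BondiData.regular

namespace BondiData.Smooth

theorem isOpen_regular (hS : S.Smooth) : IsOpen S.regular := by
  have h : ContinuousOn S.V (chart S.r₀) := (hS.metric _ (by simp)).continuousOn
  have h1 : IsOpen {x : Coord | x ∈ chart S.r₀ ∧ 0 < x 1} :=
    (isOpen_chart _).inter (isOpen_lt continuous_const (continuous_apply 1))
  have h2 : ContinuousOn (fun x => 2 + S.V x / x 1) {x : Coord | x ∈ chart S.r₀ ∧ 0 < x 1} :=
    continuousOn_const.add ((h.mono fun x hx => hx.1).div (continuous_apply 1).continuousOn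
      fun x hx => hx.2.ne')
  have h3 := h2.isOpen_inter_preimage h1 isOpen_Ioi (t := Set.Ioi 0)
  convert h3 using 1
  ext x
  exact ⟨fun h => ⟨⟨h.1, h.2.1⟩, h.2.2⟩, fun h => ⟨h.1.1, h.1.2, h.2⟩⟩

theorem contDiffOn_basic (hS : S.Smooth) :
    ∀ f ∈ [S.β, S.γ, S.δ, S.U, S.V, S.W], ContDiffOn ℝ ∞ f S.regular :=
  fun f hf => (hS.metric f hf).mono fun _ hx => hx.1

theorem contDiffOn_derived (hS : S.Smooth) :
    ∀ f ∈ [S.Lam, S.sig, S.h₁₁, S.h₁₂, S.h₂₂, S.U, S.W, S.q₁₁, S.q₁₂, S.q₂₂, S.Uψ],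
      ContDiffOn ℝ ∞ f S.regular := by
  have hβ := hS.contDiffOn_basic S.β (by simp)
  have hγ := hS.contDiffOn_basic S.γ (by simp)
  have hδ := hS.contDiffOn_basic S.δ (by simp)
  have hU := hS.contDiffOn_basic S.U (by simp)
  have hV := hS.contDiffOn_basic S.V (by simp)
  have hW := hS.contDiffOn_basic S.W (by simp)
  have hr : ContDiffOn ℝ ∞ (fun x : Coord => x 1) S.regular := (contDiff_apply ℝ ℝ 1).contDiffOn
  have hs : ContDiffOn ℝ ∞ (fun x : Coord => sin (x 2)) S.regular :=
    (contDiff_apply ℝ ℝ 2).sin.contDiffOn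
  have hv : ContDiffOn ℝ ∞ (fun x => 2 + S.V x / x 1) S.regular :=
    contDiffOn_const.add (hV.div hr fun x hx => (regular.pos hx).ne')
  have two : ∀ {c : ℝ} {f : Coord → ℝ}, ContDiffOn ℝ ∞ f S.regular →
      ContDiffOn ℝ ∞ (fun x => c * f x) S.regular := fun h => contDiffOn_const.mul h
  have hc := contDiff_cosh.comp_contDiffOn (two (c := 2) hδ)
  have h11 : ContDiffOn ℝ ∞ S.h₁₁ S.regular := (two hγ).exp.mul hc
  have h12 : ContDiffOn ℝ ∞ S.h₁₂ S.regular := contDiff_sinh.comp_contDiffOn (two hδ)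
  have h22 : ContDiffOn ℝ ∞ S.h₂₂ S.regular := (two hγ).exp.mul hc
  simp only [List.forall_mem_cons, List.not_mem_nil, false_implies, implies_true, and_true]
  exact ⟨(two hβ).exp.mul hv, hv.inv fun x hx => hx.2.2.ne', h11, h12, h22, hU, hW,
    (hr.pow 2).mul h11, ((hr.pow 2).mul h12).mul hs, ((hr.pow 2).mul h22).mul (hs.pow 2),
    hW.div hs fun x hx => (regular.sin_pos hx).ne'⟩

theorem differentiableAt (hS : S.Smooth) {f : Coord → ℝ}
    (hf : f ∈ [S.Lam, S.sig, S.h₁₁, S.h₁₂, S.h₂₂, S.U, S.W, S.q₁₁, S.q₁₂, S.q₂₂, S.Uψ])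
    (hx : x ∈ S.regular) : DifferentiableAt ℝ f x :=
  differentiableAt_of_contDiffOn hS.isOpen_regular (hS.contDiffOn_derived f hf) hx

theorem eventually_regular (hS : S.Smooth) (hy : toBondi y ∈ S.regular) :
    ∀ᶠ z in 𝓝 y, toBondi z ∈ S.regular :=
  toBondi.continuous.continuousAt.preimage_mem_nhds (hS.isOpen_regular.mem_nhds hy)

end BondiData.Smooth

theorem g_eq_jet (hy : toBondi y ∈ S.regular) : S.g y = (S.jet y).g := by
  have hs := BondiData.regular.sin_pos hy
  have hr := BondiData.regular.pos hy
  simp only [toBondi_one, toBondi_two] at hs hr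
  ext i j
  fin_cases i <;> fin_cases j <;>
    simp [BondiData.g, BondiData.metricT, Matrix.mul_apply, Fin.sum_univ_four, ← toBondi_apply,
      BondiData.metric, SliceJet.g, SliceJet.normU, SliceJet.U1low, SliceJet.U2low, BondiData.jet,
      jetOf, BondiData.Lam, BondiData.q₁₁, BondiData.q₁₂, BondiData.q₂₂, BondiData.Uψ,
      BondiData.h₁₁, BondiData.h₁₂, BondiData.h₂₂, BondiData.gUU, BondiData.quad, BondiData.gUθ,
      BondiData.gUψ, BondiData.gθψ, hs.ne'] <;>
    field_simp <;> ring

theorem shift_eq_jet (hy : toBondi y ∈ S.regular) (i : Fin 3) : S.shift i y = (S.jet y).X i := by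
  have hs := BondiData.regular.sin_pos hy
  have hr := BondiData.regular.pos hy
  have hB := BondiData.regular.Lam_mul_sig hy
  simp only [toBondi_one, toBondi_two] at hs hr
  fin_cases i <;>
    simp [BondiData.shift, BondiData.metricT, Matrix.mul_apply, Fin.sum_univ_four, ← toBondi_apply,
      BondiData.metric, SliceJet.X, SliceJet.normU, SliceJet.U1low, SliceJet.U2low, BondiData.jet,
      jetOf, hB]  <;>
    simp [BondiData.Lam, BondiData.q₁₁, BondiData.q₁₂, BondiData.q₂₂, BondiData.Uψ,
      BondiData.h₁₁, BondiData.h₁₂, BondiData.h₂₂, BondiData.gUU, BondiData.quad, BondiData.gUθ,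
      BondiData.gUψ] <;>
    field_simp <;> ring

end

section

variable {S : BondiData} {y : Coord}

theorem jet_Λ_ne (hy : toBondi y ∈ S.regular) : (S.jet y).Λ ≠ 0 :=
  (BondiData.regular.Lam_pos hy).ne'

theorem jet_det (y : Coord) : (S.jet y).det = y 1 ^ 4 * sin (y 2) ^ 2 := by
  have h := S.unimodular (toBondi y)
  simp only [SliceJet.det, BondiData.jet, jetOf, BondiData.q₁₁, BondiData.q₁₂, BondiData.q₂₂,
    toBondi_one, toBondi_two]
  linear_combination y 1 ^ 4 * sin (y 2) ^ 2 * h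

theorem jet_det_ne (hy : toBondi y ∈ S.regular) : (S.jet y).det ≠ 0 := by
  have hs := BondiData.regular.sin_pos hy
  have hr := BondiData.regular.pos hy
  simp only [toBondi_one, toBondi_two] at hs hr
  rw [jet_det]
  positivity

theorem g_inv_eq_jet (hy : toBondi y ∈ S.regular) : (S.g y)⁻¹ = (S.jet y).gInv := by
  rw [g_eq_jet hy]
  exact Matrix.inv_eq_right_inv ((S.jet y).g_mul_gInv (jet_Λ_ne hy) (jet_det_ne hy))

theorem pd_g (hS : S.Smooth) (hy : toBondi y ∈ S.regular) (μ : Fin 4) (i j : Fin 3) :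
    pd μ (fun z => S.g z i j) y = (S.jet y).dg μ i j := by
  have hd : ∀ f ∈ [S.Lam, S.sig, S.h₁₁, S.h₁₂, S.h₂₂, S.U, S.W, S.q₁₁, S.q₁₂, S.q₂₂, S.Uψ],
      DifferentiableAt ℝ (fun z => f (toBondi z)) y := fun f hf =>
    (hS.differentiableAt hf hy).comp y toBondi.differentiableAt
  rw [pd_congr μ (g := fun z => (S.jet z).g i j)
    ((hS.eventually_regular hy).mono fun z hz => by simp only [g_eq_jet hz])]
  exact pd_jetOf_g (hd _ (by simp)) (hd _ (by simp)) (hd _ (by simp)) (hd _ (by simp))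
    (hd _ (by simp)) (hd _ (by simp)) μ i j

theorem pd_shift (hS : S.Smooth) (hy : toBondi y ∈ S.regular) (μ : Fin 4) (j : Fin 3) :
    pd μ (S.shift j) y = (S.jet y).dX μ j := by
  have hd : ∀ f ∈ [S.Lam, S.sig, S.h₁₁, S.h₁₂, S.h₂₂, S.U, S.W, S.q₁₁, S.q₁₂, S.q₂₂, S.Uψ],
      DifferentiableAt ℝ (fun z => f (toBondi z)) y := fun f hf =>
    (hS.differentiableAt hf hy).comp y toBondi.differentiableAt
  rw [pd_congr μ (g := fun z => (S.jet z).X j)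
    ((hS.eventually_regular hy).mono fun z hz => shift_eq_jet hz j)]
  exact pd_jetOf_X (hd _ (by simp)) (hd _ (by simp)) (hd _ (by simp)) (hd _ (by simp))
    (hd _ (by simp)) (hd _ (by simp)) (hd _ (by simp)) μ j

theorem h_eq_jet (hS : S.Smooth) (hy : toBondi y ∈ S.regular) (i j : Fin 3) :
    S.h y i j = 1 / (2 * S.lapse y) * (S.jet y).K i j := by
  have hΓ : ∀ i j, ∑ k, S.christoffel k i j y * S.shift k y = 1 / 2 * ∑ m, (S.jet y).Xup m *
      ((S.jet y).dg i.succ m j + (S.jet y).dg j.succ m i - (S.jet y).dg m.succ i j) := by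
    intro i j
    simp only [BondiData.christoffel, g_inv_eq_jet hy, pd_g hS hy, shift_eq_jet hy]
    simp only [← (S.jet y).gInv_mul_X (jet_Λ_ne hy) (jet_det_ne hy), (S.jet y).gInv_symm 1 0,
      (S.jet y).gInv_symm 2 0, (S.jet y).gInv_symm 2 1, Fin.sum_univ_three]
    ring
  rw [BondiData.h, BondiData.covShift, BondiData.covShift, hΓ, hΓ, pd_shift hS hy, pd_shift hS hy,
    pd_g hS hy, SliceJet.K]
  congr 1
  have hsymm : ∀ m : Fin 3, (S.jet y).dg m.succ j i = (S.jet y).dg m.succ i j := by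
    intro m; fin_cases i <;> fin_cases j <;> rfl
  simp only [hsymm, Fin.sum_univ_three]
  ring

namespace SliceJet

variable (J : SliceJet)

/-- The spacetime metric in the coordinates `(t, r, θ, ψ)`. -/
def gST : Matrix (Fin 4) (Fin 4) ℝ :=
  !![J.Λ - 2 * (J.Λ * J.σ) + J.normU, J.X 0, J.X 1, J.X 2;
     J.X 0, J.Λ + J.normU, J.U1low, J.U2low;
     J.X 1, J.U1low, J.q₁₁, J.q₁₂;
     J.X 2, J.U2low, J.q₁₂, J.q₂₂]

/-- The inverse of the spacetime metric: `Λ σ²` is the square of the lapse. -/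
noncomputable def gSTInv : Matrix (Fin 4) (Fin 4) ℝ :=
  !![-1 / (J.Λ * J.σ ^ 2), (J.σ - 1) / (J.Λ * J.σ ^ 2), -J.U₁ / (J.Λ * J.σ), -J.U₂ / (J.Λ * J.σ);
     (J.σ - 1) / (J.Λ * J.σ ^ 2), (2 * J.σ - 1) / (J.Λ * J.σ ^ 2), -J.U₁ / (J.Λ * J.σ),
       -J.U₂ / (J.Λ * J.σ);
     -J.U₁ / (J.Λ * J.σ), -J.U₁ / (J.Λ * J.σ), J.q₂₂ / J.det, -J.q₁₂ / J.det;
     -J.U₂ / (J.Λ * J.σ), -J.U₂ / (J.Λ * J.σ), -J.q₁₂ / J.det, J.q₁₁ / J.det]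

theorem gST_mul_gSTInv (hΛ : J.Λ ≠ 0) (hσ : J.σ ≠ 0) (hd : J.det ≠ 0) :
    J.gST * J.gSTInv = 1 := by
  have hd' : J.q₁₁ * J.q₂₂ - J.q₁₂ ^ 2 ≠ 0 := hd
  have hd'' : J.q₂₂ * J.q₁₁ - J.q₁₂ ^ 2 ≠ 0 := by rwa [mul_comm]
  ext i j
  fin_cases i <;> fin_cases j <;>
    simp [gST, gSTInv, X, Matrix.mul_apply, Fin.sum_univ_four, normU, U1low, U2low, det] <;>
    field_simp <;> ring

end SliceJet

theorem metricT_eq_jet (hy : toBondi y ∈ S.regular) : S.metricT y = (S.jet y).gST := by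
  have hΛ := hy.2.2
  have hB := BondiData.regular.Lam_mul_sig hy
  have hX : ∀ i : Fin 3, S.metricT y 0 i.succ = (S.jet y).X i := fun i => shift_eq_jet hy i
  have hX' : ∀ i : Fin 3, S.metricT y i.succ 0 = (S.jet y).X i := by
    intro i
    rw [← hX]
    fin_cases i <;>
      simp [BondiData.metricT, Matrix.mul_apply, Fin.sum_univ_four, BondiData.metric]
  have hg : ∀ i j : Fin 3, S.metricT y i.succ j.succ = (S.jet y).g i j := fun i j => by
    rw [← g_eq_jet hy]; rfl
  have h00 : S.metricT y 0 0 = S.metricT y 1 1 - 2 * exp (2 * S.β (toBondi y)) := by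
    simp [BondiData.metricT, Matrix.mul_apply, Fin.sum_univ_four, BondiData.metric,
      ← toBondi_apply]
    ring
  ext i j
  refine Fin.cases ?_ (fun i => ?_) i <;> refine Fin.cases ?_ (fun j => ?_) j
  · rw [h00, show S.metricT y 1 1 = _ from hg 0 0, ← hB]
    simp [SliceJet.gST, SliceJet.g, BondiData.jet, jetOf]
    ring
  · rw [hX]; fin_cases j <;> rfl
  · rw [hX']; fin_cases i <;> rfl
  · rw [hg]; fin_cases i <;> fin_cases j <;> rfl

/-- The lapse is `𝒩 = e^β / √(2 + V/r)`. -/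
theorem lapse_inv (hy : toBondi y ∈ S.regular) :
    1 / (2 * S.lapse y) =
      √(2 + S.V (toBondi y) / y 1) * exp (-S.β (toBondi y)) / 2 := by
  have hv := hy.2.2
  have hB := BondiData.regular.Lam_mul_sig hy
  simp only [toBondi_one] at hv
  have h1 : -((S.metricT y)⁻¹ 0 0) =
      (2 + S.V (toBondi y) / y 1) * exp (-S.β (toBondi y)) ^ 2 := by
    rw [metricT_eq_jet hy, Matrix.inv_eq_right_inv ((S.jet y).gST_mul_gSTInv (jet_Λ_ne hy)
      (BondiData.regular.sig_pos hy).ne' (jet_det_ne hy))]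
    have h2 : (S.jet y).Λ * (S.jet y).σ = exp (2 * S.β (toBondi y)) := hB
    have h3 : (S.jet y).σ = (2 + S.V (toBondi y) / y 1)⁻¹ := by
      simp [BondiData.jet, jetOf, BondiData.sig]
    have h4 : exp (-S.β (toBondi y)) ^ 2 = (exp (2 * S.β (toBondi y)))⁻¹ := by
      rw [← exp_nat_mul, ← exp_neg]; congr 1; push_cast; ring
    change -(-1 / ((S.jet y).Λ * (S.jet y).σ ^ 2)) = _
    rw [sq, ← mul_assoc, h2, h3, h4, neg_div, neg_neg, one_div, mul_inv, inv_inv, mul_comm]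
  rw [BondiData.lapse, h1, sqrt_mul hv.le, sqrt_sq (exp_pos _).le]
  have := sqrt_pos.2 hv
  have := exp_pos (-S.β (toBondi y))
  field_simp

theorem trH_eq_jet (hS : S.Smooth) (hy : toBondi y ∈ S.regular) :
    S.trH y = 1 / (2 * S.lapse y) * ((S.jet y).Kνν / (S.jet y).Λ + (S.jet y).trK) := by
  rw [← (S.jet y).trace_K (jet_Λ_ne hy) (jet_det_ne hy), BondiData.trH, g_inv_eq_jet hy]
  simp only [h_eq_jet hS hy, Finset.mul_sum]
  exact Finset.sum_congr rfl fun i _ => Finset.sum_congr rfl fun j _ => by ring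

/-- The factor `1 / (2 𝒩)` splits off, because the momentum density is linear in `h`. -/
theorem admIntegrand_eq_jet (hS : S.Smooth) (hy : toBondi y ∈ S.regular) (k : Fin 3) :
    S.admIntegrand k y = 1 / (2 * S.lapse y) * ∑ i, dy k (y 1) (y 2) (y 3) i *
      ((S.jet y).K i 0 - (S.jet y).g i 0 * ((S.jet y).Kνν / (S.jet y).Λ + (S.jet y).trK)) := by
  simp only [BondiData.admIntegrand, trH_eq_jet hS hy, h_eq_jet hS hy, g_eq_jet hy, Finset.mul_sum]
  exact Finset.sum_congr rfl fun i _ => by ring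

end

/-! ### The momentum density without coordinate singularities -/

/-- The orthonormal components of `r ∂/∂yᵏ` tangent to the sphere. -/
noncomputable def eθ (k : Fin 3) (θ ψ : ℝ) : ℝ := ![cos θ * cos ψ, cos θ * sin ψ, -sin θ] k
/-- See `eθ`. -/
noncomputable def eψ (k : Fin 3) (_θ ψ : ℝ) : ℝ := ![-sin ψ, cos ψ, 0] k

theorem dy_zero (k : Fin 3) (r θ ψ : ℝ) : dy k r θ ψ 0 = n k θ ψ := by
  fin_cases k <;> simp [dy, n]

theorem dy_one (k : Fin 3) (r θ ψ : ℝ) : dy k r θ ψ 1 = eθ k θ ψ / r := by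
  fin_cases k <;> simp [dy, eθ, neg_div]

theorem dy_two (k : Fin 3) (r θ ψ : ℝ) : dy k r θ ψ 2 = eψ k θ ψ / (r * sin θ) := by
  fin_cases k <;> simp [dy, eψ, neg_div]

namespace BondiData

variable (S : BondiData)

/-- `r K(ν, ∂_θ)`, where `K = 2 𝒩 h` and `ν = ∂_r - U ∂_θ - (W / sin θ) ∂_ψ`. This and the
following definitions rescale the components of `K` by powers of `r` and `sin θ` to quantities
that are bounded near spatial infinity up to the poles. -/
noncomputable def kνθ (x : Coord) : ℝ :=
  -(S.h₁₁ x * (x 1 ^ 3 * pd 1 S.U x) + S.h₁₂ x * (x 1 ^ 3 * pd 1 S.W x))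
    + S.Lam x * (x 1 * pd 2 S.sig x)

/-- `r K(ν, ∂_ψ)`. -/
noncomputable def kνψ (x : Coord) : ℝ :=
  -(sin (x 2) * (S.h₁₂ x * (x 1 ^ 3 * pd 1 S.U x) + S.h₂₂ x * (x 1 ^ 3 * pd 1 S.W x)))
    + S.Lam x * (x 1 * pd 3 S.sig x)

/-- `(sin θ / r) K(∂_θ, ∂_θ)`. -/
noncomputable def kθθ (x : Coord) : ℝ :=
  (S.sig x - 1) * (2 * S.h₁₁ x + x 1 * pd 1 S.h₁₁ x) * sin (x 2)
    - S.sig x * (x 1 * pd 0 S.h₁₁ x) * sin (x 2)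
    - S.sig x * ((x 1)⁻¹ * (x 1)⁻¹ * ((x 1 ^ 2 * S.U x) * (x 1 * pd 2 S.h₁₁ x) * sin (x 2)
        + (x 1 ^ 2 * S.W x) * (x 1 * pd 3 S.h₁₁ x))
      + 2 * (x 1)⁻¹ * (S.h₁₁ x * (x 1 ^ 2 * pd 2 S.U x) * sin (x 2)
        + S.h₁₂ x * ((x 1 ^ 2 * pd 2 S.W x) * sin (x 2) - (x 1 ^ 2 * S.W x) * cos (x 2))))

/-- `r⁻¹ K(∂_θ, ∂_ψ)`. -/
noncomputable def kθψ (x : Coord) : ℝ :=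
  (S.sig x - 1) * (2 * S.h₁₂ x + x 1 * pd 1 S.h₁₂ x) * sin (x 2)
    - S.sig x * (x 1 * pd 0 S.h₁₂ x) * sin (x 2)
    - S.sig x * ((x 1)⁻¹ * (x 1)⁻¹ * ((x 1 ^ 2 * S.U x) * (x 1 * pd 2 S.h₁₂ x) * sin (x 2)
        + (x 1 ^ 2 * S.W x) * (x 1 * pd 3 S.h₁₂ x))
      + (x 1)⁻¹ * ((x 1 ^ 2 * S.U x) * S.h₁₂ x * cos (x 2)
        + S.h₁₂ x * (x 1 ^ 2 * pd 2 S.U x) * sin (x 2)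
        + S.h₂₂ x * ((x 1 ^ 2 * pd 2 S.W x) * sin (x 2) - (x 1 ^ 2 * S.W x) * cos (x 2))
        + S.h₁₁ x * (x 1 ^ 2 * pd 3 S.U x) + S.h₁₂ x * (x 1 ^ 2 * pd 3 S.W x)))

/-- `(r sin θ)⁻¹ K(∂_ψ, ∂_ψ)`. -/
noncomputable def kψψ (x : Coord) : ℝ :=
  (S.sig x - 1) * (2 * S.h₂₂ x + x 1 * pd 1 S.h₂₂ x) * sin (x 2)
    - S.sig x * (x 1 * pd 0 S.h₂₂ x) * sin (x 2)
    - S.sig x * ((x 1)⁻¹ * (x 1)⁻¹ * ((x 1 ^ 2 * S.U x) * (x 1 * pd 2 S.h₂₂ x) * sin (x 2)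
        + (x 1 ^ 2 * S.W x) * (x 1 * pd 3 S.h₂₂ x))
      + 2 * (x 1)⁻¹ * ((x 1 ^ 2 * S.U x) * S.h₂₂ x * cos (x 2)
        + S.h₁₂ x * (x 1 ^ 2 * pd 3 S.U x) + S.h₂₂ x * (x 1 ^ 2 * pd 3 S.W x)))

/-- `r² sin θ` times the trace of `K` over the spheres. -/
noncomputable def ktr (x : Coord) : ℝ :=
  4 * (x 1 * (S.sig x - 1)) * sin (x 2)
    - 2 * S.sig x * ((x 1 ^ 2 * S.U x) * cos (x 2) + (x 1 ^ 2 * pd 2 S.U x) * sin (x 2)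
      + x 1 ^ 2 * pd 3 S.W x)

/-- `r sin θ K(ν, ν)`. -/
noncomputable def kνν (x : Coord) : ℝ :=
  (S.sig x - 1) * sin (x 2) * (x 1 * pd 1 S.Lam x - x 1 * pd 0 S.Lam x)
    - S.sig x * ((x 1)⁻¹ * (x 1)⁻¹) * ((x 1 ^ 2 * S.U x) * (x 1 * pd 2 S.Lam x) * sin (x 2)
      + (x 1 ^ 2 * S.W x) * (x 1 * pd 3 S.Lam x))
    - sin (x 2) * (x 1 * pd 0 S.Lam x)
    + 2 * S.Lam x * (sin (x 2) * (x 1 * pd 1 S.sig x - x 1 * pd 0 S.sig x)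
      - (x 1)⁻¹ * (x 1)⁻¹ * ((x 1 ^ 2 * S.U x) * (x 1 * pd 2 S.sig x) * sin (x 2)
      + (x 1 ^ 2 * S.W x) * (x 1 * pd 3 S.sig x)))

/-- `r` times the component of `∂/∂yᵏ` tangent to the sphere when `∂_r` is split off along `ν`. -/
noncomputable def Eθ (k : Fin 3) (x : Coord) : ℝ :=
  eθ k (x 2) (x 3) + n k (x 2) (x 3) * (x 1)⁻¹ * (x 1 ^ 2 * S.U x)
/-- See `Eθ`. -/
noncomputable def Eψ (k : Fin 3) (x : Coord) : ℝ :=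
  eψ k (x 2) (x 3) + n k (x 2) (x 3) * (x 1)⁻¹ * (x 1 ^ 2 * S.W x)

/-- `r² sin θ` times the momentum density, as a function of `(u, r, θ, ψ)`. -/
noncomputable def density (k : Fin 3) (x : Coord) : ℝ :=
  √(2 + S.V x / x 1) * exp (-S.β x) / 2 *
    ((S.Eθ k x + n k (x 2) (x 3) * (x 1)⁻¹ * (x 1 ^ 2 * S.U x)) * S.kνθ x * sin (x 2)
    + (S.Eψ k x + n k (x 2) (x 3) * (x 1)⁻¹ * (x 1 ^ 2 * S.W x)) * S.kνψ x
    + (S.Eθ k x * (x 1 ^ 2 * S.U x) * S.kθθ x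
      + (S.Eθ k x * (x 1 ^ 2 * S.W x) + S.Eψ k x * (x 1 ^ 2 * S.U x)) * S.kθψ x
      + S.Eψ k x * (x 1 ^ 2 * S.W x) * S.kψψ x)
    - n k (x 2) (x 3) * S.Lam x * S.ktr x
    - (S.Eθ k x * (S.h₁₁ x * (x 1 ^ 2 * S.U x) + S.h₁₂ x * (x 1 ^ 2 * S.W x))
      + S.Eψ k x * (S.h₁₂ x * (x 1 ^ 2 * S.U x) + S.h₂₂ x * (x 1 ^ 2 * S.W x)))
      * (S.kνν x * (S.Lam x)⁻¹ + (x 1)⁻¹ * S.ktr x))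

end BondiData

section

variable {S : BondiData} {x y : Coord}

theorem pd_r_sq (i : Fin 4) : pd i (fun y => y 1 ^ 2) x = 2 * x 1 * if i = 1 then 1 else 0 := by
  rw [pd_comp i (F := fun t => t ^ 2) (F' := 2 * x 1) (by simpa using hasDerivAt_pow 2 (x 1))
    (by fun_prop), pd_coord]

theorem pd_sin (i : Fin 4) :
    pd i (fun y => sin (y 2)) x = cos (x 2) * if i = 2 then 1 else 0 := by
  rw [pd_comp i (hasDerivAt_sin _) (by fun_prop), pd_coord]

theorem pd_q₁₁ (hS : S.Smooth) (hx : x ∈ S.regular) (i : Fin 4) :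
    pd i S.q₁₁ x = (2 * x 1 * if i = 1 then 1 else 0) * S.h₁₁ x + x 1 ^ 2 * pd i S.h₁₁ x := by
  have h := hS.differentiableAt (f := S.h₁₁) (by simp) hx
  have e : S.q₁₁ = fun x => x 1 ^ 2 * S.h₁₁ x := rfl
  rw [e, pd_mul i (by fun_prop) h, pd_r_sq]

theorem pd_q₁₂ (hS : S.Smooth) (hx : x ∈ S.regular) (i : Fin 4) :
    pd i S.q₁₂ x = ((2 * x 1 * if i = 1 then 1 else 0) * S.h₁₂ x + x 1 ^ 2 * pd i S.h₁₂ x)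
      * sin (x 2) + x 1 ^ 2 * S.h₁₂ x * (cos (x 2) * if i = 2 then 1 else 0) := by
  have h := hS.differentiableAt (f := S.h₁₂) (by simp) hx
  have e : S.q₁₂ = fun x => x 1 ^ 2 * S.h₁₂ x * sin (x 2) := rfl
  rw [e, pd_mul i (by fun_prop) (by fun_prop), pd_mul i (by fun_prop) h, pd_r_sq, pd_sin]

theorem pd_q₂₂ (hS : S.Smooth) (hx : x ∈ S.regular) (i : Fin 4) :
    pd i S.q₂₂ x = ((2 * x 1 * if i = 1 then 1 else 0) * S.h₂₂ x + x 1 ^ 2 * pd i S.h₂₂ x)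
      * sin (x 2) ^ 2
      + x 1 ^ 2 * S.h₂₂ x * (2 * sin (x 2) * (cos (x 2) * if i = 2 then 1 else 0)) := by
  have h := hS.differentiableAt (f := S.h₂₂) (by simp) hx
  have e : S.q₂₂ = fun x => x 1 ^ 2 * S.h₂₂ x * (sin (x 2) * sin (x 2)) := by
    funext x; rw [BondiData.q₂₂]; ring
  rw [e, pd_mul i (by fun_prop) (by fun_prop), pd_mul i (by fun_prop) h, pd_r_sq,
    pd_mul i (by fun_prop) (by fun_prop), pd_sin]
  ring

theorem pd_Uψ (hS : S.Smooth) (hx : x ∈ S.regular) (i : Fin 4) :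
    pd i S.Uψ x = pd i S.W x / sin (x 2)
      - S.W x * (cos (x 2) * if i = 2 then 1 else 0) / sin (x 2) ^ 2 := by
  have h := hS.differentiableAt (f := S.W) (by simp) hx
  have hU := hS.differentiableAt (f := S.Uψ) (by simp) hx
  have hs := BondiData.regular.sin_pos hx
  have e : pd i S.W x = pd i (fun x => S.Uψ x * sin (x 2)) x := by
    refine pd_congr i (mem_of_superset (hS.isOpen_regular.mem_nhds hx) fun z hz => ?_)
    exact (div_mul_cancel₀ _ (BondiData.regular.sin_pos hz).ne').symm
  rw [e, pd_mul i hU (by fun_prop), pd_sin, BondiData.Uψ]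
  field_simp
  ring

/-- The derivative of `det h = 1`. -/
theorem pd_unimodular (hS : S.Smooth) (hx : x ∈ S.regular) (i : Fin 4) :
    pd i S.h₁₁ x * S.h₂₂ x + S.h₁₁ x * pd i S.h₂₂ x - 2 * S.h₁₂ x * pd i S.h₁₂ x = 0 := by
  have h1 := hS.differentiableAt (f := S.h₁₁) (by simp) hx
  have h2 := hS.differentiableAt (f := S.h₁₂) (by simp) hx
  have h3 := hS.differentiableAt (f := S.h₂₂) (by simp) hx
  have e : (fun x => S.h₁₁ x * S.h₂₂ x - S.h₁₂ x * S.h₁₂ x) = fun _ => 1 := by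
    funext x; rw [← S.unimodular x]; ring
  have h := pd_const i (x := x) 1
  rw [← e, pd_sub i (by fun_prop) (by fun_prop), pd_mul i h1 h3, pd_mul i h2 h2] at h
  linear_combination h

end

section

variable {S : BondiData} {y : Coord}

/-- The derivatives in the jet of the metric, in Bondi coordinates. -/
theorem jet_derivs (hS : S.Smooth) (hy : toBondi y ∈ S.regular) (μ : Fin 4) :
    (S.jet y).dΛ μ = slicePd S.Lam (toBondi y) μ ∧ (S.jet y).dσ μ = slicePd S.sig (toBondi y) μ ∧
    (S.jet y).dq₁₁ μ = slicePd S.q₁₁ (toBondi y) μ ∧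
    (S.jet y).dq₁₂ μ = slicePd S.q₁₂ (toBondi y) μ ∧
    (S.jet y).dq₂₂ μ = slicePd S.q₂₂ (toBondi y) μ ∧
    (S.jet y).dU₁ μ = slicePd S.U (toBondi y) μ ∧ (S.jet y).dU₂ μ = slicePd S.Uψ (toBondi y) μ :=
  ⟨pd_toBondi (hS.differentiableAt (by simp) hy) μ, pd_toBondi (hS.differentiableAt (by simp) hy) μ,
    pd_toBondi (hS.differentiableAt (by simp) hy) μ,
    pd_toBondi (hS.differentiableAt (by simp) hy) μ,
    pd_toBondi (hS.differentiableAt (by simp) hy) μ,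
    pd_toBondi (hS.differentiableAt (by simp) hy) μ,
    pd_toBondi (hS.differentiableAt (by simp) hy) μ⟩

theorem jet_values (y : Coord) :
    (S.jet y).Λ = S.Lam (toBondi y) ∧ (S.jet y).σ = S.sig (toBondi y) ∧
    (S.jet y).q₁₁ = S.q₁₁ (toBondi y) ∧ (S.jet y).q₁₂ = S.q₁₂ (toBondi y) ∧
    (S.jet y).q₂₂ = S.q₂₂ (toBondi y) ∧ (S.jet y).U₁ = S.U (toBondi y) ∧
    (S.jet y).U₂ = S.Uψ (toBondi y) :=
  ⟨rfl, rfl, rfl, rfl, rfl, rfl, rfl⟩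

theorem kνθ_eq (hS : S.Smooth) (hy : toBondi y ∈ S.regular) :
    (S.jet y).Kν 0 * y 1 = S.kνθ (toBondi y) := by
  have hs := BondiData.regular.sin_pos hy
  obtain ⟨v1, v2, v3, v4, v5, v6, v7⟩ := jet_values (S := S) y
  simp only [SliceJet.Kν_zero, jet_derivs hS hy, v1, v3, v4, slicePd, Matrix.cons_val,
    pd_Uψ hS hy, BondiData.q₁₁, BondiData.q₁₂, BondiData.kνθ]
  simp only [toBondi_one, toBondi_two] at hs ⊢
  simp
  field_simp

theorem kνψ_eq (hS : S.Smooth) (hy : toBondi y ∈ S.regular) :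
    (S.jet y).Kν 1 * y 1 = S.kνψ (toBondi y) := by
  have hs := BondiData.regular.sin_pos hy
  obtain ⟨v1, v2, v3, v4, v5, v6, v7⟩ := jet_values (S := S) y
  simp only [SliceJet.Kν_one, jet_derivs hS hy, v1, v5, v4, slicePd, Matrix.cons_val,
    pd_Uψ hS hy, BondiData.q₂₂, BondiData.q₁₂, BondiData.kνψ]
  simp only [toBondi_one, toBondi_two] at hs ⊢
  simp
  field_simp
  ring

theorem kθθ_eq (hS : S.Smooth) (hy : toBondi y ∈ S.regular) :
    (S.jet y).K 1 1 * sin (y 2) = S.kθθ (toBondi y) * y 1 := by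
  have hs := BondiData.regular.sin_pos hy
  have hr := BondiData.regular.pos hy
  obtain ⟨v1, v2, v3, v4, v5, v6, v7⟩ := jet_values (S := S) y
  simp only [SliceJet.K_one_one, jet_derivs hS hy, v2, v3, v4, v6, v7, slicePd, Matrix.cons_val,
    pd_Uψ hS hy, pd_q₁₁ hS hy, BondiData.q₁₁, BondiData.q₁₂, BondiData.Uψ, BondiData.kθθ]
  simp only [toBondi_one, toBondi_two] at hs hr ⊢
  simp
  field_simp

theorem kθψ_eq (hS : S.Smooth) (hy : toBondi y ∈ S.regular) :
    (S.jet y).K 1 2 = S.kθψ (toBondi y) * y 1 := by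
  have hs := BondiData.regular.sin_pos hy
  have hr := BondiData.regular.pos hy
  obtain ⟨v1, v2, v3, v4, v5, v6, v7⟩ := jet_values (S := S) y
  simp only [SliceJet.K_one_two, jet_derivs hS hy, v2, v3, v4, v5, v6, v7, slicePd,
    Matrix.cons_val, pd_Uψ hS hy, pd_q₁₂ hS hy, BondiData.q₁₁, BondiData.q₁₂, BondiData.q₂₂,
    BondiData.Uψ, BondiData.kθψ]
  simp only [toBondi_one, toBondi_two] at hs hr ⊢
  simp
  field_simp
  ring

theorem kψψ_eq (hS : S.Smooth) (hy : toBondi y ∈ S.regular) :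
    (S.jet y).K 2 2 = S.kψψ (toBondi y) * y 1 * sin (y 2) := by
  have hs := BondiData.regular.sin_pos hy
  have hr := BondiData.regular.pos hy
  obtain ⟨v1, v2, v3, v4, v5, v6, v7⟩ := jet_values (S := S) y
  simp only [SliceJet.K_two_two, jet_derivs hS hy, v2, v4, v5, v6, v7, slicePd,
    Matrix.cons_val, pd_Uψ hS hy, pd_q₂₂ hS hy, BondiData.q₁₂, BondiData.q₂₂,
    BondiData.Uψ, BondiData.kψψ]
  simp only [toBondi_one, toBondi_two] at hs hr ⊢
  simp
  field_simp
  ring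

theorem kνν_eq (hS : S.Smooth) (hy : toBondi y ∈ S.regular) :
    (S.jet y).Kνν * y 1 * sin (y 2) = S.kνν (toBondi y) := by
  have hs := BondiData.regular.sin_pos hy
  have hr := BondiData.regular.pos hy
  obtain ⟨v1, v2, v3, v4, v5, v6, v7⟩ := jet_values (S := S) y
  simp only [SliceJet.Kνν_eq, jet_derivs hS hy, v1, v2, v6, v7, slicePd,
    Matrix.cons_val, BondiData.Uψ, BondiData.kνν]
  simp only [toBondi_one, toBondi_two] at hs hr ⊢
  field_simp
  ring

/-- Since the metric of the spheres is `r²` times a unimodular one, `det q = r⁴ sin² θ`. -/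
theorem ddet_eq (hS : S.Smooth) (hy : toBondi y ∈ S.regular) :
    (S.jet y).ddet 0 = 0 ∧ (S.jet y).ddet 1 = 4 * y 1 ^ 3 * sin (y 2) ^ 2 ∧
    (S.jet y).ddet 2 = 2 * y 1 ^ 4 * sin (y 2) * cos (y 2) ∧ (S.jet y).ddet 3 = 0 := by
  have hu := S.unimodular (toBondi y)
  have d := pd_unimodular hS hy
  obtain ⟨v1, v2, v3, v4, v5, v6, v7⟩ := jet_values (S := S) y
  simp only [SliceJet.ddet, jet_derivs hS hy, v3, v4, v5, slicePd,
    Matrix.cons_val, pd_q₁₁ hS hy, pd_q₁₂ hS hy, pd_q₂₂ hS hy, BondiData.q₁₁, BondiData.q₁₂,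
    BondiData.q₂₂]
  simp only [toBondi_one, toBondi_two]
  simp
  refine ⟨?_, ?_, ?_, ?_⟩
  · linear_combination (y 1 ^ 4 * sin (y 2) ^ 2) * d 0
  · linear_combination (y 1 ^ 4 * sin (y 2) ^ 2) * (d 1 - d 0) + 4 * y 1 ^ 3 * sin (y 2) ^ 2 * hu
  · linear_combination (y 1 ^ 4 * sin (y 2) ^ 2) * d 2
      + 2 * y 1 ^ 4 * sin (y 2) * cos (y 2) * hu
  · linear_combination (y 1 ^ 4 * sin (y 2) ^ 2) * d 3

theorem ktr_eq (hS : S.Smooth) (hy : toBondi y ∈ S.regular) :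
    (S.jet y).trK * (y 1 ^ 2 * sin (y 2)) = S.ktr (toBondi y) := by
  have hs := BondiData.regular.sin_pos hy
  have hr := BondiData.regular.pos hy
  obtain ⟨v1, v2, v3, v4, v5, v6, v7⟩ := jet_values (S := S) y
  obtain ⟨d0, d1, d2, d3⟩ := ddet_eq hS hy
  rw [SliceJet.trK_eq _ (jet_det_ne hy), d0, d1, d2, d3, jet_det]
  simp only [jet_derivs hS hy, v2, v6, slicePd, Matrix.cons_val, pd_Uψ hS hy, BondiData.ktr]
  simp only [toBondi_one, toBondi_two] at hs hr ⊢
  simp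
  field_simp
  ring

/-- Multiplied by the area element, the momentum density has no singularity at the poles. -/
theorem admIntegrand_eq (hS : S.Smooth) (hy : toBondi y ∈ S.regular) (k : Fin 3) :
    S.admIntegrand k y * (y 1 ^ 2 * sin (y 2)) = S.density k (toBondi y) := by
  have hs := BondiData.regular.sin_pos hy
  have hr := BondiData.regular.pos hy
  have hΛ := BondiData.regular.Lam_pos hy
  simp only [toBondi_one, toBondi_two] at hs hr
  obtain ⟨v1, v2, v3, v4, v5, v6, v7⟩ := jet_values (S := S) y
  rw [admIntegrand_eq_jet hS hy, (S.jet y).momentum (dy k (y 1) (y 2) (y 3))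
    (S.Eθ k (toBondi y) / y 1) (S.Eψ k (toBondi y) / (y 1 * sin (y 2))) _
    ?_ ?_ (jet_Λ_ne hy) rfl, lapse_inv hy, BondiData.density, ← kνθ_eq hS hy, ← kνψ_eq hS hy,
    ← ktr_eq hS hy, ← kνν_eq hS hy, kθψ_eq hS hy, kψψ_eq hS hy,
    (eq_div_iff hs.ne').2 (kθθ_eq hS hy), dy_zero]
  · simp only [SliceJet.U1low, SliceJet.U2low, v1, v3, v4, v5, v6, v7, BondiData.q₁₁,
      BondiData.q₁₂, BondiData.q₂₂, BondiData.Uψ, toBondi_one, toBondi_two, toBondi_three]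
    set N := √(2 + S.V (toBondi y) / y 1) * exp (-S.β (toBondi y)) / 2
    field_simp
    ring
  · simp only [dy_one, dy_zero, BondiData.Eθ, v6, toBondi_one, toBondi_two, toBondi_three]
    field_simp
  · simp only [dy_two, dy_zero, BondiData.Eψ, v7, BondiData.Uψ, toBondi_one, toBondi_two,
      toBondi_three]
    field_simp

end

/-! ### Leading terms of the metric near spatial infinity -/

section

variable {S : BondiData}

theorem rIndep_l : RIndep S.l := by
  intro x y h0 h2 h3
  simp only [BondiData.l, (rIndep_lift S.c).pd 2 x y h0 h2 h3, (rIndep_lift S.d).pd 3 x y h0 h2 h3,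
    rIndep_lift S.c x y h0 h2 h3, h2]

theorem rIndep_lBar : RIndep S.lBar := by
  intro x y h0 h2 h3
  simp only [BondiData.lBar, (rIndep_lift S.c).pd 3 x y h0 h2 h3,
    (rIndep_lift S.d).pd 2 x y h0 h2 h3, rIndep_lift S.d x y h0 h2 h3, h2]

theorem offPoles_sin_ne {x : Coord} (hx : x ∈ offPoles) : sin (x 2) ≠ 0 :=
  (Real.sin_pos_of_pos_of_lt_pi hx.1 hx.2).ne'

namespace BondiData.Smooth

theorem contDiffOn_coeff (hS : S.Smooth) : ∀ a ∈ [S.c, S.d, S.M, S.C, S.H, S.p, S.pBar, S.MBar],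
    ContDiffOn ℝ ∞ (lift a) offPoles := hS.coeff

theorem contDiffOn_l (hS : S.Smooth) : ContDiffOn ℝ ∞ S.l offPoles := by
  have hc := hS.contDiffOn_coeff S.c (by simp)
  have hd := hS.contDiffOn_coeff S.d (by simp)
  have h2 : ContDiffOn ℝ ∞ (fun x : Coord => x 2) offPoles := (contDiff_apply ℝ ℝ 2).contDiffOn
  exact ((contDiffOn_pd 2 isOpen_offPoles hc).add ((contDiffOn_const.mul hc).mul
    (h2.cos.div h2.sin fun x hx => offPoles_sin_ne hx))).add
    ((contDiffOn_pd 3 isOpen_offPoles hd).div h2.sin fun x hx => offPoles_sin_ne hx)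

theorem contDiffOn_lBar (hS : S.Smooth) : ContDiffOn ℝ ∞ S.lBar offPoles := by
  have hc := hS.contDiffOn_coeff S.c (by simp)
  have hd := hS.contDiffOn_coeff S.d (by simp)
  have h2 : ContDiffOn ℝ ∞ (fun x : Coord => x 2) offPoles := (contDiff_apply ℝ ℝ 2).contDiffOn
  exact ((contDiffOn_pd 2 isOpen_offPoles hd).add ((contDiffOn_const.mul hd).mul
    (h2.cos.div h2.sin fun x hx => offPoles_sin_ne hx))).sub
    ((contDiffOn_pd 3 isOpen_offPoles hc).div h2.sin fun x hx => offPoles_sin_ne hx)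

end BondiData.Smooth

theorem eventually_offPoles : ∀ᶠ x in spatialInf, x ∈ offPoles :=
  (eventually_chart 0).mono fun _ h => h.2

theorem asymptotics_γ (hS : S.Smooth) (hO : S.OutgoingRadiation) (hD : S.ConditionD) :
    Approx (fun x => x 1 * S.γ x) (lift S.c) ∧
    ∀ i, Approx (fun x => x 1 * pd i S.γ x) (pd i (lift S.c)) := by
  have hc := hS.contDiffOn_coeff S.c (by simp)
  have hd := hS.contDiffOn_coeff S.d (by simp)
  have hC := hS.contDiffOn_coeff S.C (by simp)
  have h := expansion (k := 1) (m := 3) (N := 4) (a := lift S.c)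
    (b := fun x => lift S.C x - (1 / 6) * lift S.c x ^ 3 - (3 / 2) * lift S.c x * lift S.d x ^ 2)
    (hS.metric _ (by simp)) hc
    ((hC.sub (contDiffOn_const.mul (hc.pow 3))).sub ((contDiffOn_const.mul hc).mul (hd.pow 2)))
    (rIndep_lift _) (fun x y h0 h2 h3 => by
      simp only [rIndep_lift _ x y h0 h2 h3]) (by norm_num) (by norm_num)
    (by simpa only [pow_one] using hO.γ_exp) hD.γ_mem
  simpa only [pow_one] using And.intro h.1 h.2.1

theorem asymptotics_δ (hS : S.Smooth) (hO : S.OutgoingRadiation) (hD : S.ConditionD) :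
    Approx (fun x => x 1 * S.δ x) (lift S.d) ∧
    ∀ i, Approx (fun x => x 1 * pd i S.δ x) (pd i (lift S.d)) := by
  have hc := hS.contDiffOn_coeff S.c (by simp)
  have hd := hS.contDiffOn_coeff S.d (by simp)
  have hH := hS.contDiffOn_coeff S.H (by simp)
  have h := expansion (k := 1) (m := 3) (N := 4) (a := lift S.d)
    (b := fun x => lift S.H x + (1 / 2) * lift S.c x ^ 2 * lift S.d x - (1 / 6) * lift S.d x ^ 3)
    (hS.metric _ (by simp)) hd
    ((hH.add ((contDiffOn_const.mul (hc.pow 2)).mul hd)).sub (contDiffOn_const.mul (hd.pow 3)))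
    (rIndep_lift _) (fun x y h0 h2 h3 => by
      simp only [rIndep_lift _ x y h0 h2 h3]) (by norm_num) (by norm_num)
    (by simpa only [pow_one] using hO.δ_exp) hD.δ_mem
  simpa only [pow_one] using And.intro h.1 h.2.1

/-- Only `β = O(1/r)` and `r ∂β = O(1/r)` matter for the momentum. -/
theorem asymptotics_β (hS : S.Smooth) (hO : S.OutgoingRadiation) (hD : S.ConditionD) :
    Approx S.β (fun _ => 0) ∧ ∀ i, Approx (fun x => x 1 * pd i S.β x) fun _ => 0 := by
  have hc := hS.contDiffOn_coeff S.c (by simp)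
  have hd := hS.contDiffOn_coeff S.d (by simp)
  have h := expansion (k := 2) (m := 3) (N := 4)
    (a := fun x => -(lift S.c x ^ 2 + lift S.d x ^ 2) / 4) (b := fun _ => 0)
    (hS.metric S.β (by simp)) (((hc.pow 2).add (hd.pow 2)).neg.div_const 4) contDiffOn_const
    (fun x y h0 h2 h3 => by simp only [rIndep_lift _ x y h0 h2 h3]) (fun _ _ _ _ _ => rfl)
    (by norm_num) (by norm_num)
    (by
      refine (congrArg (IsBigORem 4) (funext fun x => ?_)).mp hO.β_exp
      rw [zero_div, add_zero, div_div]) hD.β_mem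
  refine ⟨.zero_of_bdd ?_, fun i => .zero_of_bdd ?_⟩
  · exact (inv_bdd.mul h.1.bdd).congr ((eventually_gt 0).mono fun x hx => by field_simp)
  · exact (h.2.1 i).bdd.congr (.of_forall fun x => by ring)

/-- The derivative `∂_r U` decays one order faster than `𝒞_{2,2,2}` provides, with a leading term
that is needed: `U = -l / r² + …` gives `∂_r U = 2 l / r³ + …`. -/
theorem asymptotics_U (hS : S.Smooth) (hO : S.OutgoingRadiation) (hD : S.ConditionD) :
    Approx (fun x => x 1 ^ 2 * S.U x) (fun x => -S.l x) ∧
    (∀ i, Approx (fun x => x 1 ^ 2 * pd i S.U x) fun x => -pd i S.l x) ∧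
    Approx (fun x => x 1 ^ 3 * pd 1 S.U x) (fun x => 2 * S.l x) := by
  have h := expansion (k := 2) (m := 3) (N := 4) (a := fun x => -S.l x) (b := lift S.p)
    (hS.metric _ (by simp)) hS.contDiffOn_l.neg (hS.contDiffOn_coeff S.p (by simp))
    (fun x y h0 h2 h3 => by simp only [rIndep_l x y h0 h2 h3]) (rIndep_lift _) (by norm_num)
    (by norm_num) hO.U_exp hD.U_mem
  exact ⟨h.1, fun i => (h.2.1 i).congr_right fun x => pd_neg i,
    h.2.2.congr_right fun x => by push_cast; ring⟩

theorem asymptotics_W (hS : S.Smooth) (hO : S.OutgoingRadiation) (hD : S.ConditionD) :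
    Approx (fun x => x 1 ^ 2 * S.W x) (fun x => -S.lBar x) ∧
    (∀ i, Approx (fun x => x 1 ^ 2 * pd i S.W x) fun x => -pd i S.lBar x) ∧
    Approx (fun x => x 1 ^ 3 * pd 1 S.W x) (fun x => 2 * S.lBar x) := by
  have h := expansion (k := 2) (m := 3) (N := 4) (a := fun x => -S.lBar x) (b := lift S.pBar)
    (hS.metric _ (by simp)) hS.contDiffOn_lBar.neg (hS.contDiffOn_coeff S.pBar (by simp))
    (fun x y h0 h2 h3 => by simp only [rIndep_lBar x y h0 h2 h3]) (rIndep_lift _) (by norm_num)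
    (by norm_num) hO.W_exp hD.W_mem
  exact ⟨h.1, fun i => (h.2.1 i).congr_right fun x => pd_neg i,
    h.2.2.congr_right fun x => by push_cast; ring⟩

theorem differentiableAt_two_add_V (hS : S.Smooth) {x : Coord} (hx : x ∈ chart S.r₀)
    (h0 : x 1 ≠ 0) : DifferentiableAt ℝ (fun x => 2 + S.V x / x 1) x := by
  have dV := differentiableAt_of_contDiffOn (isOpen_chart _) (hS.metric S.V (by simp)) hx
  fun_prop (disch := exact h0)

/-- The function `2 + V/r = 1 + 2M/r + O(r⁻²)`. -/
theorem asymptotics_V (hS : S.Smooth) (hO : S.OutgoingRadiation) (hD : S.ConditionD) :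
    Approx (fun x => x 1 * (2 + S.V x / x 1 - 1)) (fun x => 2 * lift S.M x) ∧
    ∀ i, Approx (fun x => x 1 * pd i (fun x => 2 + S.V x / x 1) x)
      fun x => 2 * pd i (lift S.M) x := by
  have hM := hS.contDiffOn_coeff S.M (by simp)
  have hV := hS.metric S.V (by simp)
  have h := expansion (k := 0) (m := 1) (N := 2) (f := fun x => S.V x + x 1)
    (a := fun x => 2 * lift S.M x) (b := lift S.MBar)
    (hV.add (contDiff_apply ℝ ℝ 1).contDiffOn) (contDiffOn_const.mul hM)
    (hS.contDiffOn_coeff S.MBar (by simp))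
    (fun x y h0 h2 h3 => by simp only [rIndep_lift _ x y h0 h2 h3]) (rIndep_lift _) (by norm_num)
    (by norm_num)
    (by
      refine (congrArg (IsBigORem 2) (funext fun x => ?_)).mp hO.V_exp
      rw [pow_zero, pow_one, div_one]; ring) hD.V_mem
  simp only [pow_zero, one_mul] at h
  have h1 : Approx (fun x => x 1 * (2 + S.V x / x 1 - 1)) fun x => 2 * lift S.M x := by
    refine h.1.congr_left ((eventually_gt 0).mono fun x hx => ?_)
    field_simp
    ring
  refine ⟨h1, fun i => ?_⟩
  have key : ∀ᶠ x in spatialInf, pd i (fun x => S.V x + x 1) x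
      - (if i = 1 then 1 else 0) * (2 + S.V x / x 1 - 1) =
      x 1 * pd i (fun x => 2 + S.V x / x 1) x := by
    filter_upwards [eventually_gt 0, eventually_chart S.r₀] with x hx hxc
    have dV := differentiableAt_of_contDiffOn (isOpen_chart _) hV hxc
    have d1 : DifferentiableAt ℝ (fun x : Coord => x 1) x := by fun_prop
    have dq := differentiableAt_two_add_V hS hxc hx.ne'
    have e : pd i (fun x => S.V x + x 1) x =
        pd i (fun x => x 1 * (2 + S.V x / x 1) - x 1) x := by
      refine pd_congr i ?_
      filter_upwards [(isOpen_lt continuous_const (continuous_apply 1)).mem_nhds hx] with z hz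
      have : z 1 ≠ 0 := ne_of_gt hz
      field_simp
      ring
    rw [e, pd_sub i (by fun_prop) d1, pd_mul i d1 dq, pd_coord]
    ring
  have hM' : ∀ᶠ x in spatialInf, pd i (fun x => 2 * lift S.M x) x = 2 * pd i (lift S.M) x := by
    filter_upwards [eventually_offPoles] with x hx
    have := differentiableAt_of_contDiffOn isOpen_offPoles hM hx
    rw [pd_mul i (by fun_prop) this, pd_const, zero_mul, zero_add]
  exact ((h.2.1 i).sub ((Approx.const _).mul (Approx.zero_of_bdd h1.bdd))).congr key
    (hM'.mono fun x hx => by rw [hx]; ring)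

theorem approx_two_add_V (hS : S.Smooth) (hO : S.OutgoingRadiation) (hD : S.ConditionD) :
    Approx (fun x => 2 + S.V x / x 1) fun _ => 1 := by
  have h := (Approx.const 1).add (Approx.zero_of_bdd (asymptotics_V hS hO hD).1.bdd)
  exact h.congr (.of_forall fun x => by ring) (.of_forall fun x => by ring)

theorem eventually_regular (hS : S.Smooth) (hO : S.OutgoingRadiation) (hD : S.ConditionD) :
    ∀ᶠ x in spatialInf, x ∈ S.regular := by
  filter_upwards [eventually_chart S.r₀, eventually_gt 0,
    (approx_two_add_V hS hO hD).tendsto.eventually (lt_mem_nhds one_pos)] with x h1 h2 h3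
  exact ⟨h1, h2, h3⟩

theorem asymptotics_sig (hS : S.Smooth) (hO : S.OutgoingRadiation) (hD : S.ConditionD) :
    Approx S.sig (fun _ => 1) ∧
    Approx (fun x => x 1 * (S.sig x - 1)) (fun x => -2 * lift S.M x) ∧
    ∀ i, Approx (fun x => x 1 * pd i S.sig x) fun x => -2 * pd i (lift S.M) x := by
  have hs := approx_two_add_V hS hO hD
  have hr := eventually_regular hS hO hD
  obtain ⟨h1, h2⟩ := asymptotics_V hS hO hD
  have hsig : Approx S.sig fun _ => 1 :=
    (hs.comp_const (F := fun t => t⁻¹) (differentiableAt_inv one_ne_zero)).congr_right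
      fun _ => inv_one
  refine ⟨hsig, (hsig.mul h1).neg.congr (hr.mono fun x hx => ?_)
    (.of_forall fun x => by ring), fun i => ((hsig.pow 2).mul (h2 i)).neg.congr
    (hr.mono fun x hx => ?_) (.of_forall fun x => by ring)⟩
  · have := hx.2.2.ne'
    rw [BondiData.sig]
    linear_combination -x 1 * inv_mul_cancel₀ this
  · have d := differentiableAt_two_add_V hS hx.1 hx.2.1.ne'
    have e := pd_comp i (hasDerivAt_inv hx.2.2.ne') d
    have e' : pd i S.sig x = _ := e
    rw [e', BondiData.sig, ← inv_pow]
    ring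

theorem asymptotics_Lam (hS : S.Smooth) (hO : S.OutgoingRadiation) (hD : S.ConditionD) :
    Approx S.Lam (fun _ => 1) ∧ Approx (fun x => (S.Lam x)⁻¹) (fun _ => 1) ∧
    ∀ i, Approx (fun x => x 1 * pd i S.Lam x) fun x => 2 * pd i (lift S.M) x := by
  have hs := approx_two_add_V hS hO hD
  have hr := eventually_regular hS hO hD
  obtain ⟨-, h2⟩ := asymptotics_V hS hO hD
  obtain ⟨b1, b2⟩ := asymptotics_β hS hO hD
  have hE : Approx (fun x => exp (2 * S.β x)) fun _ => 1 :=
    (b1.comp_const (F := fun t => exp (2 * t)) (by fun_prop)).congr_right fun _ => by simp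
  have hL : Approx S.Lam fun _ => 1 := (hE.mul hs).congr_right fun _ => by ring
  refine ⟨hL, (hL.comp_const (F := fun t => t⁻¹) (differentiableAt_inv one_ne_zero)).congr_right
    fun _ => inv_one, fun i => ((((Approx.const 2).mul (b2 i)).mul hL).add (hE.mul (h2 i))).congr
    (hr.mono fun x hx => ?_) (.of_forall fun x => by ring)⟩
  have dβ := differentiableAt_of_contDiffOn (isOpen_chart _) (hS.metric S.β (by simp)) hx.1
  have d := differentiableAt_two_add_V hS hx.1 hx.2.1.ne'
  have e : pd i S.Lam x = pd i (fun x => exp (2 * S.β x) * (2 + S.V x / x 1)) x := rfl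
  rw [e, pd_mul i (by fun_prop) d, pd_comp i (Real.hasDerivAt_exp _) (by fun_prop),
    pd_mul i (by fun_prop) dβ, pd_const, BondiData.Lam]
  ring

theorem pd_comp_const_mul {f : Coord → ℝ} {F F' : ℝ → ℝ} {x : Coord} (i : Fin 4)
    (hf : DifferentiableAt ℝ f x) (hF : ∀ t : ℝ, HasDerivAt F (F' t) t) (c : ℝ) :
    pd i (fun y => F (c * f y)) x = c * F' (c * f x) * pd i f x := by
  rw [pd_comp i (hF _) (by fun_prop), pd_mul i (by fun_prop) hf, pd_const]
  ring

theorem asymptotics_h₁₁ (hS : S.Smooth) (hO : S.OutgoingRadiation) (hD : S.ConditionD) :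
    Approx S.h₁₁ (fun _ => 1) ∧
    ∀ i, Approx (fun x => x 1 * pd i S.h₁₁ x) fun x => 2 * pd i (lift S.c) x := by
  obtain ⟨c0, c1⟩ := asymptotics_γ hS hO hD
  obtain ⟨d0, d1⟩ := asymptotics_δ hS hO hD
  have hE := ((Approx.zero_of_bdd c0.bdd).comp_const (F := fun t => exp (2 * t)) (by fun_prop))
  have hC := ((Approx.zero_of_bdd d0.bdd).comp_const (F := fun t => cosh (2 * t)) (by fun_prop))
  have hs := ((Approx.zero_of_bdd d0.bdd).comp_const (F := fun t => sinh (2 * t)) (by fun_prop))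
  simp only [mul_zero, exp_zero, cosh_zero, sinh_zero] at hE hC hs
  refine ⟨(hE.mul hC).congr_right fun _ => by ring, fun i =>
    ((((Approx.const 2).mul hE).mul (c1 i)).mul hC |>.add
      (hE.mul (((Approx.const 2).mul hs).mul (d1 i)))).congr
    ((eventually_chart S.r₀).mono fun x hx => ?_) (.of_forall fun x => by ring)⟩
  have dγ := differentiableAt_of_contDiffOn (isOpen_chart _) (hS.metric S.γ (by simp)) hx
  have dδ := differentiableAt_of_contDiffOn (isOpen_chart _) (hS.metric S.δ (by simp)) hx
  have e : pd i S.h₁₁ x = pd i (fun x => exp (2 * S.γ x) * cosh (2 * S.δ x)) x := rfl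
  rw [e, pd_mul i (by fun_prop) (by fun_prop), pd_comp_const_mul i dγ Real.hasDerivAt_exp,
    pd_comp_const_mul i dδ Real.hasDerivAt_cosh]
  ring

theorem asymptotics_h₂₂ (hS : S.Smooth) (hO : S.OutgoingRadiation) (hD : S.ConditionD) :
    Approx S.h₂₂ (fun _ => 1) ∧
    ∀ i, Approx (fun x => x 1 * pd i S.h₂₂ x) fun x => -2 * pd i (lift S.c) x := by
  obtain ⟨c0, c1⟩ := asymptotics_γ hS hO hD
  obtain ⟨d0, d1⟩ := asymptotics_δ hS hO hD
  have hE := ((Approx.zero_of_bdd c0.bdd).comp_const (F := fun t => exp (-2 * t)) (by fun_prop))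
  have hC := ((Approx.zero_of_bdd d0.bdd).comp_const (F := fun t => cosh (2 * t)) (by fun_prop))
  have hs := ((Approx.zero_of_bdd d0.bdd).comp_const (F := fun t => sinh (2 * t)) (by fun_prop))
  simp only [mul_zero, exp_zero, cosh_zero, sinh_zero] at hE hC hs
  refine ⟨(hE.mul hC).congr_right fun _ => by ring, fun i =>
    ((((Approx.const (-2)).mul hE).mul (c1 i)).mul hC |>.add
      (hE.mul (((Approx.const 2).mul hs).mul (d1 i)))).congr
    ((eventually_chart S.r₀).mono fun x hx => ?_) (.of_forall fun x => by ring)⟩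
  have dγ := differentiableAt_of_contDiffOn (isOpen_chart _) (hS.metric S.γ (by simp)) hx
  have dδ := differentiableAt_of_contDiffOn (isOpen_chart _) (hS.metric S.δ (by simp)) hx
  have e : pd i S.h₂₂ x = pd i (fun x => exp (-2 * S.γ x) * cosh (2 * S.δ x)) x := rfl
  rw [e, pd_mul i (by fun_prop) (by fun_prop), pd_comp_const_mul i dγ Real.hasDerivAt_exp,
    pd_comp_const_mul i dδ Real.hasDerivAt_cosh]
  ring

theorem asymptotics_h₁₂ (hS : S.Smooth) (hO : S.OutgoingRadiation) (hD : S.ConditionD) :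
    Approx S.h₁₂ (fun _ => 0) ∧
    ∀ i, Approx (fun x => x 1 * pd i S.h₁₂ x) fun x => 2 * pd i (lift S.d) x := by
  obtain ⟨d0, d1⟩ := asymptotics_δ hS hO hD
  have hC := ((Approx.zero_of_bdd d0.bdd).comp_const (F := fun t => cosh (2 * t)) (by fun_prop))
  have hs := ((Approx.zero_of_bdd d0.bdd).comp_const (F := fun t => sinh (2 * t)) (by fun_prop))
  simp only [mul_zero, cosh_zero, sinh_zero] at hC hs
  refine ⟨hs, fun i => (((Approx.const 2).mul hC).mul (d1 i)).congr
    ((eventually_chart S.r₀).mono fun x hx => ?_) (.of_forall fun x => by ring)⟩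
  have dδ := differentiableAt_of_contDiffOn (isOpen_chart _) (hS.metric S.δ (by simp)) hx
  have e : pd i S.h₁₂ x = pd i (fun x => sinh (2 * S.δ x)) x := rfl
  rw [e, pd_comp_const_mul i dδ Real.hasDerivAt_sinh]
  ring

end

/-! ### The limit of the momentum density -/

section

variable {S : BondiData}

theorem abs_mul_le_one {a b : ℝ} (ha : |a| ≤ 1) (hb : |b| ≤ 1) : |a * b| ≤ 1 := by
  rw [abs_mul]; exact mul_le_one₀ ha (abs_nonneg _) hb

theorem abs_n_le (k : Fin 3) (θ ψ : ℝ) : |n k θ ψ| ≤ 1 := by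
  fin_cases k
  exacts [abs_mul_le_one (abs_sin_le_one _) (abs_cos_le_one _),
    abs_mul_le_one (abs_sin_le_one _) (abs_sin_le_one _), abs_cos_le_one _]

theorem abs_eθ_le (k : Fin 3) (θ ψ : ℝ) : |eθ k θ ψ| ≤ 1 := by
  fin_cases k
  exacts [abs_mul_le_one (abs_cos_le_one _) (abs_cos_le_one _),
    abs_mul_le_one (abs_cos_le_one _) (abs_sin_le_one _),
    (abs_neg _).trans_le (abs_sin_le_one _)]

theorem abs_eψ_le (k : Fin 3) (θ ψ : ℝ) : |eψ k θ ψ| ≤ 1 := by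
  fin_cases k
  exacts [(abs_neg _).trans_le (abs_sin_le_one _), abs_cos_le_one _,
    (abs_zero (α := ℝ)).trans_le zero_le_one]

namespace BondiData

/-- The terms of the limiting momentum density that are linear in the metric functions. -/
noncomputable def linDensity (S : BondiData) (k : Fin 3) (x : Coord) : ℝ :=
  4 * n k (x 2) (x 3) * lift S.M x * sin (x 2)
    - n k (x 2) (x 3) * (pd 2 S.l x * sin (x 2) + S.l x * cos (x 2) + pd 3 S.lBar x)
    - eθ k (x 2) (x 3) * (S.l x + pd 2 (lift S.M) x) * sin (x 2)
    - eψ k (x 2) (x 3) * (S.lBar x * sin (x 2) + pd 3 (lift S.M) x)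

end BondiData

theorem calP_eq (k : Fin 3) (x : Coord) : S.calP k x =
    (pd 0 (lift S.c) x * (eθ k (x 2) (x 3) * S.l x - eψ k (x 2) (x 3) * S.lBar x)
    + pd 0 (lift S.d) x * (eθ k (x 2) (x 3) * S.lBar x + eψ k (x 2) (x 3) * S.l x)
    + pd 0 (lift S.M) x * (eθ k (x 2) (x 3) * S.l x + eψ k (x 2) (x 3) * S.lBar x))
      * sin (x 2) := by
  fin_cases k <;> simp [BondiData.calP, eθ, eψ] <;> ring

set_option maxHeartbeats 800000 in
/-- The density on the sphere of radius `r` is a ring expression in quantities whose limits are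
known, so its limit is obtained by substituting these. -/
theorem density_approx (hS : S.Smooth) (hO : S.OutgoingRadiation) (hD : S.ConditionD)
    (k : Fin 3) :
    Approx (S.density k) fun x => S.calP k x + S.linDensity k x := by
  obtain ⟨u0, u1, u2⟩ := asymptotics_U hS hO hD
  obtain ⟨w0, w1, w2⟩ := asymptotics_W hS hO hD
  obtain ⟨s0, s1, s2⟩ := asymptotics_sig hS hO hD
  obtain ⟨L0, L1, L2⟩ := asymptotics_Lam hS hO hD
  obtain ⟨a0, a1⟩ := asymptotics_h₁₁ hS hO hD
  obtain ⟨b0, b1⟩ := asymptotics_h₁₂ hS hO hD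
  obtain ⟨d0, d1⟩ := asymptotics_h₂₂ hS hO hD
  have hn : Approx (fun x => n k (x 2) (x 3)) fun x => n k (x 2) (x 3) :=
    .refl (.of_le 1 (.of_forall fun x => abs_n_le _ _ _))
  have hθ : Approx (fun x => eθ k (x 2) (x 3)) fun x => eθ k (x 2) (x 3) :=
    .refl (.of_le 1 (.of_forall fun x => abs_eθ_le _ _ _))
  have hψ : Approx (fun x => eψ k (x 2) (x 3)) fun x => eψ k (x 2) (x 3) :=
    .refl (.of_le 1 (.of_forall fun x => abs_eψ_le _ _ _))
  have hs : Approx (fun x => sin (x 2)) fun x => sin (x 2) := .refl (bdd_sin 2)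
  have hcos : Approx (fun x => cos (x 2)) fun x => cos (x 2) := .refl (bdd_cos 2)
  have hr : Approx (fun x => (x 1)⁻¹) fun _ => 0 := .inv_r
  have hN : Approx (fun x => √(2 + S.V x / x 1) * exp (-S.β x) / 2) fun _ => 1 / 2 := by
    have h1 := (approx_two_add_V hS hO hD).comp_const (F := fun t => √t)
      (differentiableAt_id.sqrt one_ne_zero)
    have h2 := (asymptotics_β hS hO hD).1.comp_const (F := fun t => exp (-t)) (by fun_prop)
    exact ((h1.mul h2).mul (.const (1 / 2))).congr (.of_forall fun x => by ring)
      (.of_forall fun x => by simp)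
  -- the rescaled components of the second fundamental form, factor by factor; each factor has its
  -- limit in the context
  obtain ⟨kνθ, kνψ, kθθ, kθψ, kψψ, ktr, kνν, Eθ, Eψ⟩ :
      Approx S.kνθ (fun x => -(2 * S.l x) - 2 * pd 2 (lift S.M) x) ∧
      Approx S.kνψ (fun x => -(2 * (S.lBar x * sin (x 2))) - 2 * pd 3 (lift S.M) x) ∧
      Approx S.kθθ (fun x => -(2 * pd 0 (lift S.c) x * sin (x 2))) ∧
      Approx S.kθψ (fun x => -(2 * pd 0 (lift S.d) x * sin (x 2))) ∧
      Approx S.kψψ (fun x => 2 * pd 0 (lift S.c) x * sin (x 2)) ∧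
      Approx S.ktr (fun x => -(8 * lift S.M x * sin (x 2))
        + 2 * (S.l x * cos (x 2) + pd 2 S.l x * sin (x 2) + pd 3 S.lBar x)) ∧
      Approx S.kνν (fun x => 2 * pd 0 (lift S.M) x * sin (x 2)
        - 4 * pd 1 (lift S.M) x * sin (x 2)) ∧
      Approx (S.Eθ k) (fun x => eθ k (x 2) (x 3)) ∧
      Approx (S.Eψ k) (fun x => eψ k (x 2) (x 3)) := by
    refine ⟨?_, ?_, ?_, ?_, ?_, ?_, ?_, ?_, ?_⟩ <;>
      [unfold BondiData.kνθ; unfold BondiData.kνψ; unfold BondiData.kθθ; unfold BondiData.kθψ;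
       unfold BondiData.kψψ; unfold BondiData.ktr; unfold BondiData.kνν; unfold BondiData.Eθ;
       unfold BondiData.Eψ] <;>
      (apply Approx.congr_right
       · repeat' first
          | assumption
          | apply_assumption
          | apply Approx.add
          | apply Approx.sub
          | apply Approx.neg
          | apply Approx.mul
          | apply Approx.const
       · intro x; ring)
  -- the mass aspect does not depend on `r`
  replace kνν : Approx S.kνν fun x => 2 * pd 0 (lift S.M) x * sin (x 2) :=
    kνν.congr (.of_forall fun _ => rfl) (eventually_offPoles.mono fun x hx => by
      rw [(rIndep_lift _).pd_one (differentiableAt_of_contDiffOn isOpen_offPoles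
        (hS.contDiffOn_coeff S.M (by simp)) hx)]
      ring)
  refine Approx.congr_right (hN.mul (((((((Eθ.add ((hn.mul hr).mul u0)).mul kνθ).mul hs).add
    ((Eψ.add ((hn.mul hr).mul w0)).mul kνψ)).add
    ((((Eθ.mul u0).mul kθθ).add (((Eθ.mul w0).add (Eψ.mul u0)).mul kθψ)).add
      ((Eψ.mul w0).mul kψψ))).sub ((hn.mul L0).mul ktr)).sub
    (((Eθ.mul ((a0.mul u0).add (b0.mul w0))).add (Eψ.mul ((b0.mul u0).add (d0.mul w0)))).mul
      ((kνν.mul L1).add (hr.mul ktr))))) fun x => ?_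
  rw [calP_eq, BondiData.linDensity]
  ring

end

/-! ### Integration over the spheres -/

section

open MeasureTheory

/-- The range of the angles `(θ, ψ)`, up to a null set. -/
def angleBox : Set (ℝ × ℝ) := Set.Ioo 0 π ×ˢ Set.Ioc 0 (2 * π)

theorem measurableSet_angleBox : MeasurableSet angleBox := measurableSet_Ioo.prod measurableSet_Ioc

theorem volume_angleBox_lt_top : volume angleBox < ⊤ := by
  rw [angleBox, Measure.volume_eq_prod, Measure.prod_prod]
  exact ENNReal.mul_lt_top (by simp) (by rw [Real.volume_Ioc]; exact ENNReal.ofReal_lt_top)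

theorem integrableOn_angleBox {f : ℝ × ℝ → ℝ} {K : ℝ} (hf : ContinuousOn f angleBox)
    (hK : ∀ p ∈ angleBox, |f p| ≤ K) : IntegrableOn f angleBox := by
  have : IsFiniteMeasure (volume.restrict angleBox) :=
    ⟨by simpa using volume_angleBox_lt_top⟩
  refine Integrable.of_bound (hf.aestronglyMeasurable measurableSet_angleBox) K ?_
  exact (ae_restrict_iff' measurableSet_angleBox).2 (.of_forall hK)

theorem iterated_eq_angleBox {f : ℝ × ℝ → ℝ} (hf : IntegrableOn f angleBox) :
    ∫ θ in (0 : ℝ)..π, ∫ ψ in (0 : ℝ)..(2 * π), f (θ, ψ) = ∫ p in angleBox, f p := by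
  rw [intervalIntegral.integral_of_le pi_pos.le, integral_Ioc_eq_integral_Ioo]
  simp only [intervalIntegral.integral_of_le two_pi_pos.le]
  rw [angleBox, Measure.volume_eq_prod] at *
  exact (setIntegral_prod f hf).symm

/-- A `ψ`-derivative of a periodic function integrates to zero. -/
theorem integral_angleBox_deriv_ψ {f g : ℝ × ℝ → ℝ} {K : ℝ}
    (hg : ContinuousOn g (Set.Ioo 0 π ×ˢ Set.univ)) (hK : ∀ p ∈ angleBox, |g p| ≤ K)
    (hd : ∀ θ ∈ Set.Ioo 0 π, ∀ ψ, HasDerivAt (fun s => f (θ, s)) (g (θ, ψ)) ψ)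
    (hp : ∀ θ ∈ Set.Ioo 0 π, f (θ, 0) = f (θ, 2 * π)) : ∫ p in angleBox, g p = 0 := by
  have hi := integrableOn_angleBox (hg.mono (Set.prod_mono le_rfl (Set.subset_univ _))) hK
  rw [angleBox, Measure.volume_eq_prod] at *
  rw [setIntegral_prod g hi]
  refine (setIntegral_congr_fun measurableSet_Ioo fun θ hθ => ?_).trans
    (integral_zero _ _)
  have hc : Continuous fun s => g (θ, s) :=
    hg.comp_continuous (by fun_prop) fun s => ⟨hθ, trivial⟩
  have := intervalIntegral.integral_eq_sub_of_hasDerivAt (a := 0) (b := 2 * π)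
    (fun s _ => hd θ hθ s) (hc.intervalIntegrable _ _)
  rw [intervalIntegral.integral_of_le two_pi_pos.le] at this
  rw [this, hp θ hθ, sub_self]

/-- A `θ`-derivative of a function that vanishes at the poles integrates to zero. -/
theorem integral_angleBox_deriv_θ {f g : ℝ × ℝ → ℝ} {K : ℝ}
    (hg : ContinuousOn g (Set.Ioo 0 π ×ˢ Set.univ)) (hK : ∀ p ∈ angleBox, |g p| ≤ K)
    (hd : ∀ θ ∈ Set.Ioo 0 π, ∀ ψ, HasDerivAt (fun s => f (s, ψ)) (g (θ, ψ)) θ)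
    (hp : ∀ p ∈ angleBox, |f p| ≤ K * sin p.1) : ∫ p in angleBox, g p = 0 := by
  have hi := integrableOn_angleBox (hg.mono (Set.prod_mono le_rfl (Set.subset_univ _))) hK
  rw [angleBox, Measure.volume_eq_prod] at *
  rw [← setIntegral_prod_swap, setIntegral_prod (fun z => g z.swap) hi.swap]
  refine (setIntegral_congr_fun measurableSet_Ioc fun ψ hψ => ?_).trans
    (integral_zero _ _)
  have hc : ContinuousOn (fun s => g (s, ψ)) (Set.Ioo 0 π) :=
    hg.comp (by fun_prop) fun s hs => ⟨hs, trivial⟩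
  have hint : IntervalIntegrable (fun s => g (s, ψ)) volume 0 π := by
    rw [intervalIntegrable_iff_integrableOn_Ioo_of_le pi_pos.le]
    refine Integrable.of_bound (hc.aestronglyMeasurable measurableSet_Ioo) K ?_
    exact (ae_restrict_iff' measurableSet_Ioo).2 (.of_forall fun s hs => hK (s, ψ) ⟨hs, hψ⟩)
  have lim : ∀ (l : Filter ℝ) (a : ℝ), l ≤ 𝓝 a → sin a = 0 → (∀ᶠ s in l, s ∈ Set.Ioo 0 π) →
      Tendsto (fun s => f (s, ψ)) l (𝓝 0) := by
    intro l a hl ha hs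
    refine squeeze_zero_norm' (hs.mono fun s hs => hp (s, ψ) ⟨hs, hψ⟩) ?_
    have : Tendsto (fun s => K * sin s) (𝓝 a) (𝓝 (K * sin a)) :=
      (continuous_const.mul continuous_sin).tendsto a
    rw [ha, mul_zero] at this
    exact this.mono_left hl
  have := intervalIntegral.integral_eq_sub_of_hasDerivAt_of_tendsto pi_pos
    (fun s hs => hd s hs ψ) hint
    (lim _ 0 nhdsWithin_le_nhds sin_zero (Ioo_mem_nhdsGT pi_pos))
    (lim _ π nhdsWithin_le_nhds sin_pi (Ioo_mem_nhdsLT pi_pos))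
  rw [intervalIntegral.integral_of_le pi_pos.le, integral_Ioc_eq_integral_Ioo] at this
  simpa using this

end

/-- The coordinate sphere of radius `r` at retarded time `u`. -/
def sphere (u r : ℝ) (p : ℝ × ℝ) : Coord := ![u, r, p.1, p.2]

theorem continuous_sphere (u r : ℝ) : Continuous (sphere u r) := by
  refine continuous_pi fun i => ?_
  fin_cases i <;> simp [sphere] <;> fun_prop

theorem eventually_sphere {P : Coord → Prop} (h : ∀ᶠ x in spatialInf, P x) (t₀ : ℝ) :
    ∀ᶠ r : ℝ in atTop, ∀ p ∈ angleBox, P (sphere (t₀ - r) r p) :=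
  (eventually_slice h t₀).mono fun _ hr p hp => hr p.1 p.2 hp.1.1 hp.1.2 hp.2.1.le hp.2.2

theorem Bdd.exists_le {f : Coord → ℝ} (h : Bdd f) : ∃ K, ∀ᶠ x in spatialInf, |f x| ≤ K := by
  obtain ⟨K, hK⟩ := h.bound
  exact ⟨K, hK.mono fun x hx => by simpa using hx⟩

theorem hasDerivAt_sphere_θ (u r ψ θ : ℝ) :
    HasDerivAt (fun s => sphere u r (s, ψ)) (Pi.single 2 1) θ := by
  rw [hasDerivAt_pi]
  intro i
  fin_cases i <;> simp [sphere]
  all_goals first | exact hasDerivAt_const _ _ | exact hasDerivAt_id _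

theorem hasDerivAt_sphere_ψ (u r θ ψ : ℝ) :
    HasDerivAt (fun s => sphere u r (θ, s)) (Pi.single 3 1) ψ := by
  rw [hasDerivAt_pi]
  intro i
  fin_cases i <;> simp [sphere]
  all_goals first | exact hasDerivAt_const _ _ | exact hasDerivAt_id _

section

variable {S : BondiData}

/-- The leading coefficient of a function with equal values at `ψ = 0` and `ψ = 2π` has the same
property. -/
theorem periodic_of_approx {f g a : Coord → ℝ} {r₀ : ℝ} (h : Approx g a) (ia : RIndep a)
    (hf : EqualAtEnds r₀ f)
    (hg : ∀ x y : Coord, f x = f y → x 1 = y 1 → g x = g y) :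
    ∃ u₁, ∀ u ≤ u₁, ∀ r θ, 0 < θ → θ < π → a ![u, r, θ, 0] = a ![u, r, θ, 2 * π] := by
  obtain ⟨K, hK⟩ := h.1.bound
  obtain ⟨u₁, R, hR⟩ := eventually_spatialInf.1 hK
  refine ⟨u₁, fun u hu r θ h0 hπ => ?_⟩
  have key : ∀ s : ℝ, max R (max (r₀ + 1) 1) ≤ s →
      |a ![u, r, θ, 0] - a ![u, r, θ, 2 * π]| ≤ 2 * K * s⁻¹ := by
    intro s hs
    have hsR : R ≤ s := (le_max_left _ _).trans hs
    have hs0 : r₀ < s := by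
      linarith [(le_max_left (r₀ + 1) 1).trans ((le_max_right R _).trans hs)]
    have hs1 : 1 ≤ s := (le_max_right (r₀ + 1) 1).trans ((le_max_right R _).trans hs)
    have e1 := hR ![u, s, θ, 0] ⟨by simpa using hu, by simpa using hsR, by
      simp [Angles, h0, hπ, pi_pos.le]⟩
    have e2 := hR ![u, s, θ, 2 * π] ⟨by simpa using hu, by simpa using hsR, by
      simp [Angles, h0, hπ, pi_pos.le]⟩
    rw [hg ![u, s, θ, 0] ![u, s, θ, 2 * π] (hf u s θ hs0 h0 hπ).1 (by simp)] at e1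
    rw [ia ![u, s, θ, 0] ![u, r, θ, 0] (by simp) (by simp) (by simp)] at e1
    rw [ia ![u, s, θ, 2 * π] ![u, r, θ, 2 * π] (by simp) (by simp) (by simp)] at e2
    have hpos : 0 ≤ s⁻¹ := inv_nonneg.2 (by linarith)
    simp only [Matrix.cons_val_one, Matrix.cons_val_zero, norm_eq_abs, abs_of_nonneg hpos] at e1 e2
    rw [abs_le] at *
    constructor <;> linarith [e1.1, e1.2, e2.1, e2.2]
  have lim : Tendsto (fun s : ℝ => 2 * K * s⁻¹) atTop (𝓝 0) := by
    simpa using tendsto_inv_atTop_zero.const_mul (2 * K)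
  have := ge_of_tendsto lim ((eventually_ge_atTop _).mono key)
  exact sub_eq_zero.1 (abs_nonpos_iff.1 this)

end

/-! ### The momentum integrals -/

theorem hasDerivAt_n_θ (k : Fin 3) (θ ψ : ℝ) : HasDerivAt (fun s => n k s ψ) (eθ k θ ψ) θ := by
  fin_cases k
  exacts [(hasDerivAt_sin θ).mul_const _, (hasDerivAt_sin θ).mul_const _, hasDerivAt_cos θ]

theorem hasDerivAt_n_ψ (k : Fin 3) (θ ψ : ℝ) :
    HasDerivAt (fun s => n k θ s) (sin θ * eψ k θ ψ) ψ := by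
  fin_cases k
  · exact (hasDerivAt_cos ψ).const_mul _
  · exact (hasDerivAt_sin ψ).const_mul _
  · exact (hasDerivAt_const ψ _).congr_deriv (mul_zero _).symm

theorem hasDerivAt_eθ_θ (k : Fin 3) (θ ψ : ℝ) : HasDerivAt (fun s => eθ k s ψ) (-n k θ ψ) θ := by
  fin_cases k
  · exact ((hasDerivAt_cos θ).mul_const _).congr_deriv (by simp [n])
  · exact ((hasDerivAt_cos θ).mul_const _).congr_deriv (by simp [n])
  · exact (hasDerivAt_sin θ).neg

theorem hasDerivAt_eψ_ψ (k : Fin 3) (θ ψ : ℝ) :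
    HasDerivAt (fun s => eψ k θ s) (-(n k θ ψ * sin θ + eθ k θ ψ * cos θ)) ψ := by
  fin_cases k
  · exact (hasDerivAt_sin ψ).neg.congr_deriv (by
      simp [n, eθ]; linear_combination cos ψ * sin_sq_add_cos_sq θ)
  · exact (hasDerivAt_cos ψ).congr_deriv (by
      simp [n, eθ]; linear_combination sin ψ * sin_sq_add_cos_sq θ)
  · exact (hasDerivAt_const ψ _).congr_deriv (by simp [n, eθ]; ring)

theorem continuous_n (k : Fin 3) : Continuous fun x : Coord => n k (x 2) (x 3) := by
  fin_cases k <;> simp [n] <;> fun_prop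

theorem continuous_eθ (k : Fin 3) : Continuous fun x : Coord => eθ k (x 2) (x 3) := by
  fin_cases k <;> simp [eθ] <;> fun_prop

theorem continuous_eψ (k : Fin 3) : Continuous fun x : Coord => eψ k (x 2) (x 3) := by
  fin_cases k <;> simp [eψ] <;> fun_prop

theorem toBondi_sphere (t r θ ψ : ℝ) : toBondi ![t, r, θ, ψ] = sphere (t - r) r (θ, ψ) := by
  simp [toBondi_apply, sphere]

namespace BondiData

variable (S : BondiData)

/-- `∂_θ (sin θ (n^k l + e^k_θ M))`. -/
noncomputable def divθ (k : Fin 3) (x : Coord) : ℝ :=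
  cos (x 2) * (n k (x 2) (x 3) * S.l x + eθ k (x 2) (x 3) * lift S.M x)
    + sin (x 2) * (eθ k (x 2) (x 3) * S.l x + n k (x 2) (x 3) * pd 2 S.l x
      + (-n k (x 2) (x 3) * lift S.M x + eθ k (x 2) (x 3) * pd 2 (lift S.M) x))

/-- `∂_ψ (n^k l̄ + e^k_ψ M)`. -/
noncomputable def divψ (k : Fin 3) (x : Coord) : ℝ :=
  sin (x 2) * eψ k (x 2) (x 3) * S.lBar x + n k (x 2) (x 3) * pd 3 S.lBar x
    + (-(n k (x 2) (x 3) * sin (x 2) + eθ k (x 2) (x 3) * cos (x 2)) * lift S.M x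
      + eψ k (x 2) (x 3) * pd 3 (lift S.M) x)

end BondiData

section

variable {S : BondiData}

/-- The linear part of the limiting density is the Bondi momentum density up to a divergence: the
divergence of `l` cancels because `n^k` has gradient `e^k`, and the gradient of `M` contributes
because `e^k` has divergence `-2 n^k`. -/
theorem linDensity_eq (k : Fin 3) (x : Coord) : S.linDensity k x =
    2 * (lift S.M x * n k (x 2) (x 3) * sin (x 2)) - S.divθ k x - S.divψ k x := by
  simp only [BondiData.linDensity, BondiData.divθ, BondiData.divψ]
  ring

theorem sphere_mem_offPoles {u r : ℝ} {p : ℝ × ℝ} (hp : p.1 ∈ Set.Ioo 0 π) :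
    sphere u r p ∈ offPoles := by
  simpa [sphere, offPoles] using hp

theorem continuousOn_sphere {F : Coord → ℝ} (hF : ContinuousOn F offPoles) (u r : ℝ) :
    ContinuousOn (fun p => F (sphere u r p)) (Set.Ioo 0 π ×ˢ Set.univ) :=
  hF.comp (continuous_sphere u r).continuousOn fun _ hp => sphere_mem_offPoles hp.1

theorem continuousOn_sphere' {F : Coord → ℝ} (hF : ContinuousOn F offPoles) (u r : ℝ) :
    ContinuousOn (fun p => F (sphere u r p)) angleBox :=
  (continuousOn_sphere hF u r).mono (Set.prod_mono le_rfl (Set.subset_univ _))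

/-- Continuity of the coefficient functions that enter the limiting density. -/
theorem continuousOn_coeffs (hS : S.Smooth) (k : Fin 3) :
    ContinuousOn (S.calP k) offPoles ∧ ContinuousOn (S.divθ k) offPoles ∧
    ContinuousOn (S.divψ k) offPoles ∧
    ContinuousOn (fun x => lift S.M x * n k (x 2) (x 3) * sin (x 2)) offPoles := by
  have pdc : ∀ {f : Coord → ℝ} (i : Fin 4), ContDiffOn ℝ ∞ f offPoles →
      ContinuousOn (pd i f) offPoles := fun i hf =>
    (contDiffOn_pd i isOpen_offPoles hf).continuousOn
  have hc := pdc 0 (hS.contDiffOn_coeff S.c (by simp))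
  have hd := pdc 0 (hS.contDiffOn_coeff S.d (by simp))
  have hM := hS.contDiffOn_coeff S.M (by simp)
  have hM0 := pdc 0 hM
  have hM2 := pdc 2 hM
  have hM3 := pdc 3 hM
  have hl2 := pdc 2 hS.contDiffOn_l
  have hl3 := pdc 3 hS.contDiffOn_lBar
  have hMc := hM.continuousOn
  have hl := hS.contDiffOn_l.continuousOn
  have hlB := hS.contDiffOn_lBar.continuousOn
  have hn := (continuous_n k).continuousOn (s := offPoles)
  have hθ := (continuous_eθ k).continuousOn (s := offPoles)
  have hψ := (continuous_eψ k).continuousOn (s := offPoles)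
  have hs : ContinuousOn (fun x : Coord => sin (x 2)) offPoles := by fun_prop
  have hcos : ContinuousOn (fun x : Coord => cos (x 2)) offPoles := by fun_prop
  have hP : S.calP k = _ := funext (calP_eq k)
  rw [hP]
  unfold BondiData.divθ BondiData.divψ
  refine ⟨?_, ?_, ?_, ?_⟩ <;> fun_prop

/-- Boundedness near spatial infinity of the coefficient functions that enter the limiting
density. -/
theorem bdd_coeffs (hS : S.Smooth) (hO : S.OutgoingRadiation) (hD : S.ConditionD) (k : Fin 3) :
    Bdd (S.calP k) ∧ Bdd (S.divθ k) ∧ Bdd (S.divψ k) ∧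
    Bdd (fun x => lift S.M x * n k (x 2) (x 3) * sin (x 2)) ∧
    Bdd (fun x => n k (x 2) (x 3) * S.l x + eθ k (x 2) (x 3) * lift S.M x) := by
  have neg' : ∀ {f : Coord → ℝ}, Bdd (fun x => -f x) → Bdd f := fun h =>
    h.neg.congr (.of_forall fun x => neg_neg _)
  have half : ∀ {f : Coord → ℝ} (c : ℝ), c ≠ 0 → Bdd (fun x => c * f x) → Bdd f := fun c hc h =>
    ((Bdd.const c⁻¹).mul h).congr (.of_forall fun x => by field_simp)
  have hc := ((asymptotics_γ hS hO hD).2 0).2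
  have hd := ((asymptotics_δ hS hO hD).2 0).2
  have hM := half 2 two_ne_zero (asymptotics_V hS hO hD).1.2
  have hM0 := half 2 two_ne_zero ((asymptotics_V hS hO hD).2 0).2
  have hM2 := half 2 two_ne_zero ((asymptotics_V hS hO hD).2 2).2
  have hM3 := half 2 two_ne_zero ((asymptotics_V hS hO hD).2 3).2
  have hl := neg' (asymptotics_U hS hO hD).1.2
  have hlB := neg' (asymptotics_W hS hO hD).1.2
  have hl2 := neg' ((asymptotics_U hS hO hD).2.1 2).2
  have hl3 := neg' ((asymptotics_W hS hO hD).2.1 3).2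
  have hn : Bdd fun x => n k (x 2) (x 3) := .of_le 1 (.of_forall fun x => abs_n_le _ _ _)
  have hθ : Bdd fun x => eθ k (x 2) (x 3) := .of_le 1 (.of_forall fun x => abs_eθ_le _ _ _)
  have hψ : Bdd fun x => eψ k (x 2) (x 3) := .of_le 1 (.of_forall fun x => abs_eψ_le _ _ _)
  have hs := bdd_sin 2
  have hcos := bdd_cos 2
  have hP : S.calP k = _ := funext (calP_eq k)
  rw [hP]
  refine ⟨((hc.mul ((hθ.mul hl).sub (hψ.mul hlB))).add
    (hd.mul ((hθ.mul hlB).add (hψ.mul hl)))).add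
    (hM0.mul ((hθ.mul hl).add (hψ.mul hlB))) |>.mul hs, ?_, ?_, (hM.mul hn).mul hs,
    (hn.mul hl).add (hθ.mul hM)⟩
  · exact (hcos.mul ((hn.mul hl).add (hθ.mul hM))).add
      (hs.mul (((hθ.mul hl).add (hn.mul hl2)).add ((hn.neg.mul hM).add (hθ.mul hM2))))
  · exact (((hs.mul hψ).mul hlB).add (hn.mul hl3)).add
      ((((hn.mul hs).add (hθ.mul hcos)).neg.mul hM).add (hψ.mul hM3))

theorem continuousOn_density (hS : S.Smooth) (k : Fin 3) :
    ContinuousOn (S.density k) S.regular := by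
  have hc : ∀ f ∈ [S.Lam, S.sig, S.h₁₁, S.h₁₂, S.h₂₂, S.U, S.W, S.q₁₁, S.q₁₂, S.q₂₂, S.Uψ],
      ContinuousOn f S.regular ∧ ∀ i, ContinuousOn (pd i f) S.regular := fun f hf =>
    ⟨(hS.contDiffOn_derived f hf).continuousOn, fun i =>
      (contDiffOn_pd i hS.isOpen_regular (hS.contDiffOn_derived f hf)).continuousOn⟩
  obtain ⟨L0, L1⟩ := hc S.Lam (by simp)
  obtain ⟨s0, s1⟩ := hc S.sig (by simp)
  obtain ⟨a0, a1⟩ := hc S.h₁₁ (by simp)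
  obtain ⟨b0, b1⟩ := hc S.h₁₂ (by simp)
  obtain ⟨d0, d1⟩ := hc S.h₂₂ (by simp)
  obtain ⟨u0, u1⟩ := hc S.U (by simp)
  obtain ⟨w0, w1⟩ := hc S.W (by simp)
  have hr : ∀ x ∈ S.regular, x 1 ≠ 0 := fun x hx => (BondiData.regular.pos hx).ne'
  have hL : ∀ x ∈ S.regular, S.Lam x ≠ 0 := fun x hx => (BondiData.regular.Lam_pos hx).ne'
  have hn := (continuous_n k).continuousOn (s := S.regular)
  have hθ := (continuous_eθ k).continuousOn (s := S.regular)
  have hψ := (continuous_eψ k).continuousOn (s := S.regular)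
  have hβ := (hS.contDiffOn_basic S.β (by simp)).continuousOn
  have hV := (hS.contDiffOn_basic S.V (by simp)).continuousOn
  have hi : ContinuousOn (fun x : Coord => (x 1)⁻¹) S.regular :=
    (continuous_apply 1).continuousOn.inv₀ hr
  have kνθ : ContinuousOn S.kνθ S.regular := by
    have := u1 1; have := w1 1; have := s1 2
    unfold BondiData.kνθ; fun_prop
  have kνψ : ContinuousOn S.kνψ S.regular := by
    have := u1 1; have := w1 1; have := s1 3
    unfold BondiData.kνψ; fun_prop
  have kθθ : ContinuousOn S.kθθ S.regular := by
    have := a1 1; have := a1 0; have := a1 2; have := a1 3; have := u1 2; have := w1 2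
    unfold BondiData.kθθ; fun_prop (disch := assumption)
  have kθψ : ContinuousOn S.kθψ S.regular := by
    have := b1 1; have := b1 0; have := b1 2; have := b1 3; have := u1 2; have := w1 2
    have := u1 3; have := w1 3
    unfold BondiData.kθψ; fun_prop (disch := assumption)
  have kψψ : ContinuousOn S.kψψ S.regular := by
    have := d1 1; have := d1 0; have := d1 2; have := d1 3; have := u1 3; have := w1 3
    unfold BondiData.kψψ; fun_prop (disch := assumption)
  have ktr : ContinuousOn S.ktr S.regular := by
    have := u1 2; have := w1 3
    unfold BondiData.ktr; fun_prop
  have kνν : ContinuousOn S.kνν S.regular := by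
    have := L1 0; have := L1 1; have := L1 2; have := L1 3
    have := s1 0; have := s1 1; have := s1 2; have := s1 3
    unfold BondiData.kνν; fun_prop (disch := assumption)
  have hEθ : ContinuousOn (S.Eθ k) S.regular := by
    unfold BondiData.Eθ; fun_prop (disch := assumption)
  have hEψ : ContinuousOn (S.Eψ k) S.regular := by
    unfold BondiData.Eψ; fun_prop (disch := assumption)
  unfold BondiData.density
  fun_prop (disch := assumption)

end

section

open MeasureTheory

variable {S : BondiData}

/-- No regularity at the poles is needed: boundedness makes `sin θ (n^k l + e^k_θ M)` vanish
there. -/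
theorem integral_divθ (hS : S.Smooth) (hO : S.OutgoingRadiation) (hD : S.ConditionD)
    (k : Fin 3) (t₀ : ℝ) :
    ∀ᶠ r in atTop, ∫ p in angleBox, S.divθ k (sphere (t₀ - r) r p) = 0 := by
  obtain ⟨-, h1, -, -, h2⟩ := bdd_coeffs hS hO hD k
  obtain ⟨K₁, h1⟩ := h1.exists_le
  obtain ⟨K₂, h2⟩ := h2.exists_le
  filter_upwards [eventually_sphere h1 t₀, eventually_sphere h2 t₀] with r e1 e2
  refine integral_angleBox_deriv_θ (K := max K₁ K₂)
    (f := fun p => sin p.1 * (n k p.1 p.2 * S.l (sphere (t₀ - r) r p)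
      + eθ k p.1 p.2 * lift S.M (sphere (t₀ - r) r p)))
    (continuousOn_sphere (continuousOn_coeffs hS k).2.1 _ _)
    (fun p hp => (e1 p hp).trans (le_max_left _ _)) ?_ ?_
  · intro θ hθ ψ
    have hx : sphere (t₀ - r) r (θ, ψ) ∈ offPoles := sphere_mem_offPoles hθ
    have dl := hasDerivAt_line 2 (differentiableAt_of_contDiffOn isOpen_offPoles hS.contDiffOn_l hx)
      (hasDerivAt_sphere_θ (t₀ - r) r ψ θ) rfl
    have dM := hasDerivAt_line 2 (differentiableAt_of_contDiffOn isOpen_offPoles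
      (hS.contDiffOn_coeff S.M (by simp)) hx) (hasDerivAt_sphere_θ (t₀ - r) r ψ θ) rfl
    exact ((hasDerivAt_sin θ).mul (((hasDerivAt_n_θ k θ ψ).mul dl).add
      ((hasDerivAt_eθ_θ k θ ψ).mul dM)))
  · intro p hp
    have hs : 0 ≤ sin p.1 := (Real.sin_pos_of_pos_of_lt_pi hp.1.1 hp.1.2).le
    rw [abs_mul, abs_of_nonneg hs, mul_comm]
    exact mul_le_mul_of_nonneg_right ((e2 p hp).trans (le_max_right _ _)) hs

/-- The boundary values at `ψ = 0` and `ψ = 2π` agree, because Condition A passes from `V` and `W`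
to the leading coefficients `M` and `l̄` of their expansions. -/
theorem integral_divψ (hS : S.Smooth) (hO : S.OutgoingRadiation) (hA : S.ConditionA)
    (hD : S.ConditionD) (k : Fin 3) (t₀ : ℝ) :
    ∀ᶠ r in atTop, ∫ p in angleBox, S.divψ k (sphere (t₀ - r) r p) = 0 := by
  obtain ⟨-, -, h1, -, -⟩ := bdd_coeffs hS hO hD k
  obtain ⟨K, h1⟩ := h1.exists_le
  obtain ⟨u₁, hM⟩ := periodic_of_approx (f := S.V) (asymptotics_V hS hO hD).1
    (fun x y h0 h2 h3 => by simp only [rIndep_lift S.M x y h0 h2 h3]) (hA S.V (by simp))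
    (fun x y h h1 => by simp only [h, h1])
  obtain ⟨u₂, hl⟩ := periodic_of_approx (f := S.W) (asymptotics_W hS hO hD).1
    (fun x y h0 h2 h3 => by simp only [rIndep_lBar x y h0 h2 h3]) (hA S.W (by simp))
    (fun x y h h1 => by simp only [h, h1])
  filter_upwards [eventually_sphere h1 t₀, eventually_ge_atTop (t₀ - u₁),
    eventually_ge_atTop (t₀ - u₂)] with r e1 r1 r2
  refine integral_angleBox_deriv_ψ (K := K)
    (f := fun p => n k p.1 p.2 * S.lBar (sphere (t₀ - r) r p)
      + eψ k p.1 p.2 * lift S.M (sphere (t₀ - r) r p))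
    (continuousOn_sphere (continuousOn_coeffs hS k).2.2.1 _ _) e1 ?_ ?_
  · intro θ hθ ψ
    have hx : sphere (t₀ - r) r (θ, ψ) ∈ offPoles := sphere_mem_offPoles hθ
    have dl := hasDerivAt_line 3 (differentiableAt_of_contDiffOn isOpen_offPoles
      hS.contDiffOn_lBar hx) (hasDerivAt_sphere_ψ (t₀ - r) r θ ψ) rfl
    have dM := hasDerivAt_line 3 (differentiableAt_of_contDiffOn isOpen_offPoles
      (hS.contDiffOn_coeff S.M (by simp)) hx) (hasDerivAt_sphere_ψ (t₀ - r) r θ ψ) rfl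
    exact (((hasDerivAt_n_ψ k θ ψ).mul dl).add ((hasDerivAt_eψ_ψ k θ ψ).mul dM))
  · intro θ hθ
    have e2 := hM (t₀ - r) (by linarith) r θ hθ.1 hθ.2
    have e3 := hl (t₀ - r) (by linarith) r θ hθ.1 hθ.2
    have en : n k θ 0 = n k θ (2 * π) := by fin_cases k <;> simp [n]
    have ee : eψ k θ 0 = eψ k θ (2 * π) := by fin_cases k <;> simp [eψ]
    simp only [sphere, en, ee]
    rw [mul_left_cancel₀ two_ne_zero e2, neg_injective e3]

theorem bondiMomentum_eq (hS : S.Smooth) (k : Fin 3) {u r K : ℝ}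
    (hK : ∀ p ∈ angleBox,
      |(fun x => lift S.M x * n k (x 2) (x 3) * sin (x 2)) (sphere u r p)| ≤ K) :
    4 * π * S.bondiMomentum k u = ∫ p in angleBox,
      (fun x => lift S.M x * n k (x 2) (x 3) * sin (x 2)) (sphere u r p) := by
  rw [← iterated_eq_angleBox (integrableOn_angleBox
    (continuousOn_sphere' (continuousOn_coeffs hS k).2.2.2 u r) hK), BondiData.bondiMomentum,
    ← mul_assoc, mul_one_div_cancel (by positivity), one_mul]
  rfl

theorem newsIntegral_eq (hS : S.Smooth) (k : Fin 3) {u r K : ℝ}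
    (hK : ∀ p ∈ angleBox, |S.calP k (sphere u r p)| ≤ K) :
    S.newsIntegral k u = ∫ p in angleBox, S.calP k (sphere u r p) := by
  rw [← iterated_eq_angleBox (integrableOn_angleBox
    (continuousOn_sphere' (continuousOn_coeffs hS k).1 u r) hK), BondiData.newsIntegral]
  have h : RIndep (S.calP k) := by
    intro x y h0 h2 h3
    simp only [calP_eq, (rIndep_lift S.c).pd 0 x y h0 h2 h3, (rIndep_lift S.d).pd 0 x y h0 h2 h3,
      (rIndep_lift S.M).pd 0 x y h0 h2 h3, rIndep_l x y h0 h2 h3, rIndep_lBar x y h0 h2 h3, h2, h3]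
  have e : ∀ θ ψ, S.calP k ![u, 1, θ, ψ] = S.calP k (sphere u r (θ, ψ)) := fun θ ψ =>
    h _ _ (by simp [sphere]) (by simp [sphere]) (by simp [sphere])
  simp only [e]

theorem admMomentumAt_eq (hS : S.Smooth) (k : Fin 3) {t₀ r K : ℝ}
    (hreg : ∀ p ∈ angleBox, sphere (t₀ - r) r p ∈ S.regular)
    (hK : ∀ p ∈ angleBox, |S.density k (sphere (t₀ - r) r p)| ≤ K) :
    IntegrableOn (fun p => S.density k (sphere (t₀ - r) r p)) angleBox ∧
    8 * π * S.admMomentumAt k t₀ r = ∫ p in angleBox, S.density k (sphere (t₀ - r) r p) := by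
  have hi : IntegrableOn (fun p => S.density k (sphere (t₀ - r) r p)) angleBox :=
    integrableOn_angleBox ((continuousOn_density hS k).comp
      (continuous_sphere _ _).continuousOn hreg) hK
  have he : Set.EqOn (fun p => S.density k (sphere (t₀ - r) r p))
      (fun p : ℝ × ℝ => S.admIntegrand k ![t₀, r, p.1, p.2] * (r ^ 2 * sin p.1)) angleBox := by
    intro p hp
    have := admIntegrand_eq hS (y := ![t₀, r, p.1, p.2])
      (by rw [toBondi_sphere]; exact hreg p hp) k
    rw [toBondi_sphere] at this
    exact this.symm
  refine ⟨hi, ?_⟩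
  rw [setIntegral_congr_fun measurableSet_angleBox he,
    ← iterated_eq_angleBox (hi.congr_fun he measurableSet_angleBox), BondiData.admMomentumAt,
    ← mul_assoc, mul_one_div_cancel (by positivity), one_mul]

/-- The momentum integral over large spheres approaches the Bondi momentum plus the integral of
the densities `𝒫`. -/
theorem tendsto_admMomentumAt_sub (hS : S.Smooth) (hO : S.OutgoingRadiation) (hA : S.ConditionA)
    (hD : S.ConditionD) (t₀ : ℝ) (k : Fin 3) :
    Tendsto (fun r : ℝ => S.admMomentumAt k t₀ r -
      (S.bondiMomentum k (t₀ - r) + 1 / (8 * π) * S.newsIntegral k (t₀ - r))) atTop (𝓝 0) := by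
  obtain ⟨bP, bθ, bψ, bM, -⟩ := bdd_coeffs hS hO hD k
  have happ := density_approx hS hO hD k
  obtain ⟨KP, bP⟩ := bP.exists_le
  obtain ⟨Kθ, bθ⟩ := bθ.exists_le
  obtain ⟨Kψ, bψ⟩ := bψ.exists_le
  obtain ⟨KM, bM⟩ := bM.exists_le
  obtain ⟨KD, bD⟩ := happ.bdd.exists_le
  obtain ⟨K, hK⟩ := happ.1.bound
  have key : ∀ᶠ r : ℝ in atTop, ‖S.admMomentumAt k t₀ r -
      (S.bondiMomentum k (t₀ - r) + 1 / (8 * π) * S.newsIntegral k (t₀ - r))‖ ≤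
      1 / (8 * π) * (K * volume.real angleBox) * r⁻¹ := by
    filter_upwards [eventually_sphere bP t₀, eventually_sphere bθ t₀, eventually_sphere bψ t₀,
      eventually_sphere bM t₀, eventually_sphere bD t₀, eventually_sphere hK t₀,
      eventually_sphere (eventually_regular hS hO hD) t₀, integral_divθ hS hO hD k t₀,
      integral_divψ hS hO hA hD k t₀, eventually_gt_atTop 0] with r eP eθ eψ eM eD eK ereg iθ iψ hr
    obtain ⟨cP, cθ, cψ, cM⟩ := continuousOn_coeffs hS k
    have intP := integrableOn_angleBox (continuousOn_sphere' cP (t₀ - r) r) eP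
    have intθ := integrableOn_angleBox (continuousOn_sphere' cθ (t₀ - r) r) eθ
    have intψ := integrableOn_angleBox (continuousOn_sphere' cψ (t₀ - r) r) eψ
    have intM := integrableOn_angleBox (continuousOn_sphere' cM (t₀ - r) r) eM
    obtain ⟨intD, hadm⟩ := admMomentumAt_eq hS k ereg eD
    have hm := bondiMomentum_eq hS k eM
    beta_reduce at hm
    have hnews := newsIntegral_eq hS k eP
    have intMθ : IntegrableOn (fun p => 2 * (lift S.M (sphere (t₀ - r) r p)
        * n k (sphere (t₀ - r) r p 2) (sphere (t₀ - r) r p 3) * sin (sphere (t₀ - r) r p 2))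
        - S.divθ k (sphere (t₀ - r) r p)) angleBox := (intM.const_mul 2).sub intθ
    have intMθψ : IntegrableOn (fun p => 2 * (lift S.M (sphere (t₀ - r) r p)
        * n k (sphere (t₀ - r) r p 2) (sphere (t₀ - r) r p 3) * sin (sphere (t₀ - r) r p 2))
        - S.divθ k (sphere (t₀ - r) r p) - S.divψ k (sphere (t₀ - r) r p)) angleBox :=
      intMθ.sub intψ
    -- the two divergences drop out
    have hlin : ∫ p in angleBox, (S.calP k (sphere (t₀ - r) r p)
        + S.linDensity k (sphere (t₀ - r) r p)) =
        S.newsIntegral k (t₀ - r) + 8 * π * S.bondiMomentum k (t₀ - r) := by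
      simp only [linDensity_eq]
      rw [integral_add intP intMθψ, integral_sub intMθ intψ,
        integral_sub (intM.const_mul 2) intθ, iθ, iψ, integral_const_mul, ← hm, ← hnews]
      ring
    have intL : IntegrableOn (fun p => S.calP k (sphere (t₀ - r) r p)
        + S.linDensity k (sphere (t₀ - r) r p)) angleBox := by
      simp only [linDensity_eq]
      exact intP.add intMθψ
    have hbound := norm_setIntegral_le_of_norm_le_const (C := K * r⁻¹) volume_angleBox_lt_top
      (f := fun p => S.density k (sphere (t₀ - r) r p) - (S.calP k (sphere (t₀ - r) r p)
        + S.linDensity k (sphere (t₀ - r) r p))) fun p hp => by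
          simpa [sphere, abs_of_pos hr] using eK p hp
    rw [integral_sub intD intL, hlin, ← hadm] at hbound
    have e : S.admMomentumAt k t₀ r -
        (S.bondiMomentum k (t₀ - r) + 1 / (8 * π) * S.newsIntegral k (t₀ - r)) =
        1 / (8 * π) * (8 * π * S.admMomentumAt k t₀ r -
          (S.newsIntegral k (t₀ - r) + 8 * π * S.bondiMomentum k (t₀ - r))) := by
      field_simp
      ring
    rw [e, norm_mul, norm_of_nonneg (by positivity)]
    calc _ ≤ 1 / (8 * π) * (K * r⁻¹ * volume.real angleBox) := by gcongr
      _ = _ := by ring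
  refine squeeze_zero_norm' key ?_
  simpa using tendsto_inv_atTop_zero.const_mul (1 / (8 * π) * (K * volume.real angleBox))

end

end BondiADM

theorem theorem4p1 (S : BondiADM.BondiData) (hS : S.Smooth) (hO : S.OutgoingRadiation)
    (hA : S.ConditionA) (hB : S.ConditionB) (hD : S.ConditionD) (t₀ : ℝ) (k : Fin 3) :
    Tendsto (fun r : ℝ => S.admMomentumAt k t₀ r -
        (S.bondiMomentum k (t₀ - r) + 1 / (8 * π) * S.newsIntegral k (t₀ - r))) atTop (𝓝 0) ∧
    ∀ mInf : ℝ, Tendsto (S.bondiMomentum k) atBot (𝓝 mInf) →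
      ∀ L : ℝ, Tendsto (S.newsIntegral k) atBot (𝓝 L) ↔
        Tendsto (S.admMomentumAt k t₀) atTop (𝓝 (mInf + 1 / (8 * π) * L)) := by
  have h := BondiADM.tendsto_admMomentumAt_sub hS hO hA hD t₀ k
  have hbot : Tendsto (fun r : ℝ => t₀ - r) atTop atBot :=
    tendsto_const_nhds.add_atBot tendsto_neg_atTop_atBot
  have htop : Tendsto (fun u : ℝ => t₀ - u) atBot atTop :=
    tendsto_const_nhds.add_atTop tendsto_neg_atBot_atTop
  refine ⟨h, fun mInf hm L => ⟨fun hL => ?_, fun hP => ?_⟩⟩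
  · have := h.add ((hm.comp hbot).add ((hL.comp hbot).const_mul (1 / (8 * π))))
    rw [zero_add] at this
    exact this.congr fun r => sub_add_cancel _ _
  · have h1 := ((hP.sub h).sub (hm.comp hbot)).const_mul (8 * π)
    have h2 := h1.comp htop
    have e : 8 * π * (mInf + 1 / (8 * π) * L - 0 - mInf) = L := by field_simp; ring
    rw [e] at h2
    refine h2.congr fun u => ?_
    simp only [Function.comp_apply, sub_sub_cancel]
    field_simp
    ring
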